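/- Fix $b>0$ and $d>0$. For $a>0$ and $z\in[0,1]$ let $$p_a(z)=\frac{1-z^2}{\sqrt{a^2(1-z^2)+b^2z^2}},\qquad q_a(z)=-a^2\,\frac{a^2(1-z^2)+b^2(1+z^2)}{d^2\,\big(a^2(1-z^2)+b^2z^2\big)^{3/2}},$$ and, for smooth $v\colon[0,1)\to\mathbb R$, let $\mathcal L_a(v)=\frac1{p_a}\big(-(p_a v')'+q_a v\big)$. Set $$V_{\rm even}=\{v\in C^\infty([0,1)) : v'(0)=0,\ \lim_{z\nearrow1}p_a(z)v'(z)=0\},\qquad V_{\rm odd}=\{v\in C^\infty([0,1)) : v(0)=0,\ \lim_{z\nearrow1}p_a(z)v'(z)=0\}.$$ Let $(\mathcal P_a)_{\rm even}$ and $(\mathcal P_a)_{\rm odd}$ be the singular Sturm–Liouville eigenvalue problems $\mathcal L_a(v)=\lambda v$, $v\not\equiv0$, on $V_{\rm even}$ and $V_{\rm odd}$, respectively. For every $a>0$ the eigenvalues of each problem form a strictly increasing sequence tending to $+\infty$, denoted $(\lambda_n^{\rm even}(a))_{n\ge0}$ and $(\lambda_n^{\rm odd}(a))_{n\ge0}$.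 The degeneracy instants, i.e. the values $a>0$ for which $0$ is an eigenvalue of $(\mathcal P_a)_{\rm even}$, respectively of $(\mathcal P_a)_{\rm odd}$, form strictly increasing sequences tending to $+\infty$, denoted $(a_n^{\rm even})_{n\ge1}$, respectively $(a_n^{\rm odd})_{n\ge0}$. Moreover: 1. For all $a>0$, the eigenvalues interlace: $$\lambda_0^{\rm even}(a)<\lambda_0^{\rm odd}(a)<\lambda_1^{\rm even}(a)<\lambda_1^{\rm odd}(a)<\dots<\lambda_n^{\rm even}(a)<\lambda_n^{\rm odd}(a)<\lambda_{n+1}^{\rm even}(a)<\cdots.$$ 2. For each $n\ge0$, $\lambda_n^{\rm even}(a)<0$ and $\lambda_n^{\rm odd}(a)<0$ for all sufficiently large $a$. 3. $\lambda_0^{\rm even}(a)<0$ for all $a>0$. 4. For each $n\ge1$, $\lambda_n^{\rm even}$ crosses zero exactly at $a_n^{\rm even}$: $\lambda_n^{\rm even}(a)>0$ for $0<a<a_n^{\rm even}$, $\lambda_n^{\rm even}(a_n^{\rm even})=0$, and $\lambda_n^{\rm even}(a)<0$ for $a>a_n^{\rm even}$. 5. For each $n\ge0$, $\lambda_n^{\rm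 odd}$ crosses zero exactly at $a_n^{\rm odd}$: $\lambda_n^{\rm odd}(a)>0$ for $0<a<a_n^{\rm odd}$, $\lambda_n^{\rm odd}(a_n^{\rm odd})=0$, and $\lambda_n^{\rm odd}(a)<0$ for $a>a_n^{\rm odd}$. 6. The degeneracy instants interlace: $$d=a_0^{\rm odd}<a_1^{\rm even}<a_1^{\rm odd}<a_2^{\rm even}<\dots<a_n^{\rm even}<a_n^{\rm odd}<a_{n+1}^{\rm even}<\cdots.$$ -/

import Mathlib

open Set Filter Topology
open scoped ContDiff

noncomputable section

namespace EllipsoidSL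

/-- The leading coefficient `p_a(z) = (1 - z²) / √(a²(1 - z²) + b² z²)`. -/
def p (a b z : ℝ) : ℝ :=
  (1 - z ^ 2) / Real.sqrt (a ^ 2 * (1 - z ^ 2) + b ^ 2 * z ^ 2)

/-- The potential
`q_a(z) = -a² (a²(1 - z²) + b²(1 + z²)) / (d² (a²(1 - z²) + b² z²)^{3/2})`. -/
def q (a b d z : ℝ) : ℝ :=
  -a ^ 2 * ((a ^ 2 * (1 - z ^ 2) + b ^ 2 * (1 + z ^ 2)) /
    (d ^ 2 * (a ^ 2 * (1 - z ^ 2) + b ^ 2 * z ^ 2) ^ (3 / 2 : ℝ)))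

/-- The derivative of a function on `[0, 1)` (one-sided at `0`). -/
def der (v : ℝ → ℝ) (z : ℝ) : ℝ := derivWithin v (Ico 0 1) z

/-- The operator `L_a(v) = (1 / p_a) (-(p_a v')' + q_a v)` on functions on `[0, 1)`. -/
def L (a b d : ℝ) (v : ℝ → ℝ) (z : ℝ) : ℝ :=
  1 / p a b z * (-der (fun t => p a b t * der v t) z + q a b d z * v z)

/-- Smooth functions on `[0, 1)` with `v'(0) = 0` and `p_a(z) v'(z) → 0` as `z ↗ 1`. A function on
`[0, 1)` is represented by a function on `ℝ` whose values outside `[0, 1)` are irrelevant. -/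
def VEven (a b : ℝ) : Set (ℝ → ℝ) :=
  {v | ContDiffOn ℝ ∞ v (Ico 0 1) ∧ der v 0 = 0 ∧
    Tendsto (fun z => p a b z * der v z) (𝓝[<] 1) (𝓝 0)}

/-- Smooth functions on `[0, 1)` with `v(0) = 0` and `p_a(z) v'(z) → 0` as `z ↗ 1`. -/
def VOdd (a b : ℝ) : Set (ℝ → ℝ) :=
  {v | ContDiffOn ℝ ∞ v (Ico 0 1) ∧ v 0 = 0 ∧
    Tendsto (fun z => p a b z * der v z) (𝓝[<] 1) (𝓝 0)}

/-- The set of eigenvalues of the problem `L_a(v) = λ v` on a space `V` of functions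
on `[0, 1)`. -/
def eigenvalues (a b d : ℝ) (V : Set (ℝ → ℝ)) : Set ℝ :=
  {lam | ∃ v ∈ V, (∃ z ∈ Ico (0 : ℝ) 1, v z ≠ 0) ∧
    ∀ z ∈ Ico (0 : ℝ) 1, L a b d v z = lam * v z}

/-- The spectrum of `(P_a)_even`. -/
def specEven (a b d : ℝ) : Set ℝ := eigenvalues a b d (VEven a b)

/-- The spectrum of `(P_a)_odd`. -/
def specOdd (a b d : ℝ) : Set ℝ := eigenvalues a b d (VOdd a b)

/-- The even degeneracy instants: those `a > 0` for which `0` is an eigenvalue of `(P_a)_even`. -/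
def degEven (b d : ℝ) : Set ℝ := {a | 0 < a ∧ (0 : ℝ) ∈ specEven a b d}

/-- The odd degeneracy instants: those `a > 0` for which `0` is an eigenvalue of `(P_a)_odd`. -/
def degOdd (b d : ℝ) : Set ℝ := {a | 0 < a ∧ (0 : ℝ) ∈ specOdd a b d}

/-- The sequence `(s_n)_{n ≥ k}` is strictly increasing, tends to `+∞`, and its terms are exactly
the elements of `S`. For given `S` and `k` this determines `s_n` for every `n ≥ k`. -/
def Enumerates (s : ℕ → ℝ) (k : ℕ) (S : Set ℝ) : Prop :=
  StrictMonoOn s (Ici k) ∧ Tendsto s atTop atTop ∧ s '' Ici k = S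

end EllipsoidSL

end

/-! The proof is a shooting argument from the singular endpoint, recorded by a Prüfer angle. With `y
= b z / √W`, `x = 1 - y`, `β = b² / a²` and `c = b² / d²`, the eigenvalue equation becomes the
system `w' = -m U`, `(x U)' = g w`, where `m = 1 / ((1 + y) S)`, `g = c (1 + 1/S) + λ β² (1 - y²) /
S²` and `S = β (1 - y²) + y²`. The singular endpoint `z = 1` is now `x = 0`, and `z = 0` is `x = 1`.
The Volterra series `sol` gives the regular solution with `w(0) = 1`; every solution whose flux
vanishes at the singular endpoint has zero Wronskian with it (`IsEigen.wronskian_eq_zero`).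

Write `w = R cos θ`, `x U = R sin θ` with `θ(0) = 0`, and let `Theta` be `θ(1)`. Then `λ` is an even
eigenvalue iff `sin Theta = 0` and an odd one iff `cos Theta = 0` (`mem_specEven_iff`,
`mem_specOdd_iff`).

The Riccati-type equation `θ' = g cos² θ + (m / x) sin² θ` yields a comparison principle
(`angle_le`, `angle_lt`). In `λ`, the angle is continuous, strictly increasing, greater than `-π/2`,
negative somewhere and unbounded above. So it takes each value `nπ` and `nπ + π/2` with `n ≥ 0`
exactly once, and these are the even and odd eigenvalues.

At `λ = 0` the angle is positive and strictly increasing in `a` (`Theta_pos`, `Theta_strictAnti`),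
and unbounded. At `a = d` the function `v(z) = z` is the regular solution and the angle is `π/2`
(`Theta_self`). The degeneracy instants are therefore the solutions of `Theta = nπ` with `n ≥ 1` and
`Theta = nπ + π/2` with `n ≥ 0`. The signs of the eigenvalues and all interlacings reduce to
comparing values of two monotone functions. -/

/-! ### Regular solutions at a singular endpoint -/

namespace SingularSL

section Volterra

variable {Λ : Type*}

/-- The terms of the Volterra series of the regular solution of `w' = -m U`, `(x U)' = g w`. -/
noncomputable def term (m g : Λ → ℝ → ℝ) : ℕ → Λ → ℝ → ℝ
  | 0, _, _ => 1
  | n + 1, l, x => -(x * ∫ s in (0 : ℝ)..1, m l (s * x) *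
      ∫ r in (0 : ℝ)..1, g l (r * (s * x)) * term m g n l (r * (s * x)))

/-- The regular solution, normalised by `w(0) = 1`. -/
noncomputable def sol (m g : Λ → ℝ → ℝ) (l : Λ) (x : ℝ) : ℝ := ∑' n, term m g n l x

/-- The rescaled flux `U(x) = x⁻¹ ∫₀ˣ g w` of the regular solution. -/
noncomputable def flux (m g : Λ → ℝ → ℝ) (l : Λ) (x : ℝ) : ℝ :=
  ∫ r in (0 : ℝ)..1, g l (r * x) * sol m g l (r * x)

variable {m g : Λ → ℝ → ℝ}

theorem mul_mem_Icc_neg {R s x : ℝ} (hs : s ∈ Icc (0 : ℝ) 1) (hx : x ∈ Icc (-R) R) :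
    s * x ∈ Icc (-R) R := by
  rw [mem_Icc, ← abs_le] at hx ⊢
  rw [abs_mul, abs_of_nonneg hs.1]
  nlinarith [abs_nonneg x, hs.2]

/-- Both integrals are taken over `[0, 1]` by rescaling, so the singular factor `1/x` never appears.
The inner average is merely bounded, and the outer integral of `s ^ n` produces the factorial. -/
theorem abs_term_le {l : Λ} {R M : ℝ} (hM : 0 ≤ M)
    (hml : ∀ x ∈ Icc (-R) R, |m l x| ≤ M) (hgl : ∀ x ∈ Icc (-R) R, |g l x| ≤ M) (n : ℕ) :
    ∀ x ∈ Icc (-R) R, |term m g n l x| ≤ (M ^ 2 * |x|) ^ n / n.factorial := by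
  have hscale : ∀ x ∈ Icc (-R) R, ∀ s ∈ Icc (0 : ℝ) 1, s * x ∈ Icc (-R) R := by
    exact fun x hx s hs => mul_mem_Icc_neg hs hx
  induction n with
  | zero => intro x _; simp [term]
  | succ n ih =>
    intro x hx
    have hin : ∀ s ∈ Icc (0 : ℝ) 1,
        |∫ r in (0 : ℝ)..1, g l (r * (s * x)) * term m g n l (r * (s * x))|
          ≤ M * ((M ^ 2 * |s * x|) ^ n / n.factorial) := by
      intro s hs
      have := intervalIntegral.norm_integral_le_of_norm_le_const (a := (0 : ℝ)) (b := 1)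
        (f := fun r => g l (r * (s * x)) * term m g n l (r * (s * x)))
        (C := M * ((M ^ 2 * |s * x|) ^ n / n.factorial)) (by
          intro r hr
          rw [uIoc_of_le zero_le_one] at hr
          have hr' : r ∈ Icc (0 : ℝ) 1 := ⟨hr.1.le, hr.2⟩
          have hsx := hscale x hx s hs
          have hrs := hscale _ hsx r hr'
          rw [Real.norm_eq_abs, abs_mul]
          refine mul_le_mul (hgl _ hrs) ((ih _ hrs).trans ?_) (abs_nonneg _) hM
          have : |r * (s * x)| ≤ |s * x| := by
            rw [abs_mul, abs_of_nonneg hr'.1]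
            nlinarith [abs_nonneg (s * x), hr'.2]
          gcongr)
      simpa using this
    have hout := intervalIntegral.norm_integral_le_of_norm_le (a := (0 : ℝ)) (b := 1)
      (μ := MeasureTheory.volume)
      (f := fun s => m l (s * x) *
        ∫ r in (0 : ℝ)..1, g l (r * (s * x)) * term m g n l (r * (s * x)))
      (g := fun s => M ^ 2 * (M ^ 2 * |x|) ^ n / n.factorial * s ^ n) zero_le_one
      (by
        refine Eventually.of_forall fun s hs => ?_
        have hs' : s ∈ Icc (0 : ℝ) 1 := ⟨hs.1.le, hs.2⟩
        rw [Real.norm_eq_abs, abs_mul]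
        refine (mul_le_mul (hml _ (hscale x hx s hs')) (hin s hs') (abs_nonneg _) hM).trans
          (le_of_eq ?_)
        rw [abs_mul, abs_of_nonneg hs'.1]
        ring)
      (Continuous.intervalIntegrable (by fun_prop) _ _)
    rw [intervalIntegral.integral_const_mul, integral_pow] at hout
    simp only [term, abs_neg, abs_mul]
    refine (mul_le_mul_of_nonneg_left hout (abs_nonneg x)).trans (le_of_eq ?_)
    rw [Nat.factorial_succ]
    push_cast
    have : (n.factorial : ℝ) ≠ 0 := by positivity
    field_simp
    simp
    ring

variable [TopologicalSpace Λ]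

theorem continuous_integral_comp_mul {Y : Type*} [TopologicalSpace Y] {f : Y → ℝ → ℝ} {u : Y → ℝ}
    (hf : Continuous (Function.uncurry f)) (hu : Continuous u) :
    Continuous fun y => ∫ r in (0 : ℝ)..1, f y (r * u y) := by
  apply intervalIntegral.continuous_parametric_intervalIntegral_of_continuous'
    (f := fun y r => f y (r * u y))
  exact hf.comp (continuous_fst.prodMk (continuous_snd.mul (hu.comp continuous_fst)))

theorem continuous_term (hm : Continuous (Function.uncurry m)) (hg : Continuous (Function.uncurry g))
    (n : ℕ) : Continuous (Function.uncurry (term m g n)) := by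
  induction n with
  | zero => exact continuous_const
  | succ n ih =>
    have h1 : Continuous fun y : Λ × ℝ =>
        ∫ r in (0 : ℝ)..1, g y.1 (r * y.2) * term m g n y.1 (r * y.2) := by
      refine continuous_integral_comp_mul (f := fun (y : Λ × ℝ) t => g y.1 t * term m g n y.1 t)
        (u := fun y => y.2) ?_ continuous_snd
      have h2 : Continuous fun y : (Λ × ℝ) × ℝ => ((y.1.1, y.2) : Λ × ℝ) := by fun_prop
      exact (hg.comp h2).mul (ih.comp h2)
    have h3 : Continuous fun y : Λ × ℝ => ∫ s in (0 : ℝ)..1, m y.1 (s * y.2) *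
        ∫ r in (0 : ℝ)..1, g y.1 (r * (s * y.2)) * term m g n y.1 (r * (s * y.2)) := by
      refine continuous_integral_comp_mul (f := fun (y : Λ × ℝ) t => m y.1 t *
        ∫ r in (0 : ℝ)..1, g y.1 (r * t) * term m g n y.1 (r * t))
        (u := fun y => y.2) ?_ continuous_snd
      have h2 : Continuous fun y : (Λ × ℝ) × ℝ => ((y.1.1, y.2) : Λ × ℝ) := by fun_prop
      exact (hm.comp h2).mul (h1.comp h2)
    exact (continuous_snd.mul h3).neg

theorem eventually_abs_le (hm : Continuous (Function.uncurry m)) (l₀ : Λ) (R : ℝ) :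
    ∃ M, 0 ≤ M ∧ ∀ᶠ l in 𝓝 l₀, ∀ x ∈ Icc (-R) R, |m l x| ≤ M := by
  obtain ⟨M, hM⟩ := (isCompact_Icc (a := -R) (b := R)).exists_bound_of_continuousOn
    (f := m l₀) (hm.comp (Continuous.prodMk_right l₀)).continuousOn
  refine ⟨|M| + 1, by positivity, ?_⟩
  refine isCompact_Icc.eventually_forall_of_forall_eventually
    (P := fun l x => |m l x| ≤ |M| + 1) fun x hx => ?_
  have h1 : |Function.uncurry m (l₀, x)| < |M| + 1 := by
    have := hM x hx
    rw [Real.norm_eq_abs] at this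
    exact (this.trans (le_abs_self M)).trans_lt (lt_add_one _)
  filter_upwards [(hm.abs.continuousAt (x := (l₀, x))).eventually_lt_const h1] with z hz
  exact hz.le

theorem exists_term_bound (hm : Continuous (Function.uncurry m))
    (hg : Continuous (Function.uncurry g)) (l₀ : Λ) (R : ℝ) :
    ∃ u : ℕ → ℝ, Summable u ∧ ∀ᶠ l in 𝓝 l₀, ∀ n, ∀ x ∈ Icc (-R) R, |term m g n l x| ≤ u n := by
  obtain ⟨M, hM0, hM⟩ := eventually_abs_le hm l₀ R
  obtain ⟨N, hN0, hN⟩ := eventually_abs_le hg l₀ R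
  refine ⟨fun n => (max M N ^ 2 * R) ^ n / n.factorial, Real.summable_pow_div_factorial _, ?_⟩
  filter_upwards [hM, hN] with l h1 h2 n x hx
  refine (abs_term_le (hM0.trans (le_max_left M N)) (fun y hy => (h1 y hy).trans (le_max_left _ _))
    (fun y hy => (h2 y hy).trans (le_max_right _ _)) n x hx).trans ?_
  have := abs_le.2 hx
  gcongr

theorem continuous_sol (hm : Continuous (Function.uncurry m))
    (hg : Continuous (Function.uncurry g)) : Continuous (Function.uncurry (sol m g)) := by
  rw [continuous_iff_continuousAt]
  rintro ⟨l₀, x₀⟩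
  obtain ⟨u, hu, hb⟩ := exists_term_bound hm hg l₀ (|x₀| + 1)
  set s : Set (Λ × ℝ) :=
    {l | ∀ n, ∀ x ∈ Icc (-(|x₀| + 1)) (|x₀| + 1), |term m g n l x| ≤ u n} ×ˢ
      Icc (-(|x₀| + 1)) (|x₀| + 1) with hs
  have hmem : s ∈ 𝓝 (l₀, x₀) := by
    refine prod_mem_nhds hb (Icc_mem_nhds ?_ ?_)
    · linarith [neg_abs_le x₀]
    · linarith [le_abs_self x₀]
  have hc : ContinuousOn (fun y : Λ × ℝ => ∑' n, Function.uncurry (term m g n) y) s :=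
    continuousOn_tsum (fun n => (continuous_term hm hg n).continuousOn) hu
      (fun n y hy => hy.1 n y.2 hy.2)
  exact hc.continuousAt hmem

theorem hasSum_sol (hm : Continuous (Function.uncurry m))
    (hg : Continuous (Function.uncurry g)) (l : Λ) (x : ℝ) :
    HasSum (fun n => term m g n l x) (sol m g l x) := by
  obtain ⟨u, hu, hb⟩ := exists_term_bound hm hg l |x|
  exact (Summable.of_norm_bounded hu fun n => hb.self_of_nhds n x (abs_le.1 le_rfl)).hasSum

theorem hasSum_integral_comp_mul {f : ℕ → ℝ → ℝ} {F : ℝ → ℝ} {k : ℝ → ℝ} {u : ℕ → ℝ} (x : ℝ)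
    (hk : Continuous k) (hf : ∀ n, Continuous (f n)) (hu : Summable u)
    (hb : ∀ n, ∀ y ∈ Icc (-|x|) |x|, |f n y| ≤ u n)
    (hF : ∀ y, HasSum (fun n => f n y) (F y)) :
    HasSum (fun n => ∫ s in (0 : ℝ)..1, k (s * x) * f n (s * x))
      (∫ s in (0 : ℝ)..1, k (s * x) * F (s * x)) := by
  obtain ⟨K, hK⟩ := (isCompact_Icc (a := -|x|) (b := |x|)).exists_bound_of_continuousOn
    hk.continuousOn
  refine intervalIntegral.hasSum_integral_of_dominated_convergence (fun n _ => K * u n)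
    (fun n => ?_) (fun n => ?_) ?_ ?_ ?_
  · exact Continuous.aestronglyMeasurable (by have := hf n; fun_prop)
  · refine Eventually.of_forall fun s hs => ?_
    rw [uIoc_of_le zero_le_one] at hs
    have hsx : s * x ∈ Icc (-|x|) |x| := mul_mem_Icc_neg ⟨hs.1.le, hs.2⟩ (abs_le.1 le_rfl)
    rw [norm_mul]
    exact mul_le_mul (hK _ hsx) (hb n _ hsx) (norm_nonneg _) ((norm_nonneg _).trans (hK _ hsx))
  · exact Eventually.of_forall fun s _ => hu.mul_left K
  · exact Continuous.intervalIntegrable continuous_const _ _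
  · exact Eventually.of_forall fun s _ => (hF (s * x)).mul_left _

theorem continuous_flux (hm : Continuous (Function.uncurry m))
    (hg : Continuous (Function.uncurry g)) : Continuous (Function.uncurry (flux m g)) := by
  refine continuous_integral_comp_mul (f := fun (y : Λ × ℝ) t => g y.1 t * sol m g y.1 t)
    (u := fun y => y.2) ?_ continuous_snd
  have h2 : Continuous fun y : (Λ × ℝ) × ℝ => ((y.1.1, y.2) : Λ × ℝ) := by fun_prop
  exact (hg.comp h2).mul ((continuous_sol hm hg).comp h2)

/-- Termwise integration of the series; the index shift `n ↦ n + 1` is exactly the integral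
operator, and the zeroth term is the constant `1`. -/
theorem sol_eq (hm : Continuous (Function.uncurry m)) (hg : Continuous (Function.uncurry g))
    (l : Λ) (x : ℝ) :
    sol m g l x = 1 - ∫ t in (0 : ℝ)..x, m l t * flux m g l t := by
  obtain ⟨u, hu, hb⟩ := exists_term_bound hm hg l |x|
  have hml : Continuous (m l) := hm.comp (Continuous.prodMk_right l)
  have hgl : Continuous (g l) := hg.comp (Continuous.prodMk_right l)
  have htl : ∀ n, Continuous (term m g n l) :=
    fun n => (continuous_term hm hg n).comp (Continuous.prodMk_right l)
  obtain ⟨K, hK⟩ := (isCompact_Icc (a := -|x|) (b := |x|)).exists_bound_of_continuousOn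
    hgl.continuousOn
  have hfl : ∀ y, HasSum (fun n => ∫ r in (0 : ℝ)..1, g l (r * y) * term m g n l (r * y))
      (flux m g l y) := by
    intro y
    obtain ⟨u', hu', hb'⟩ := exists_term_bound hm hg l |y|
    exact hasSum_integral_comp_mul y hgl htl hu' hb'.self_of_nhds (hasSum_sol hm hg l)
  have h2 := hasSum_integral_comp_mul (u := fun n => K * u n) x hml
    (f := fun n y => ∫ r in (0 : ℝ)..1, g l (r * y) * term m g n l (r * y))
    (fun n => by
      have := htl n
      exact continuous_integral_comp_mul (f := fun (_ : ℝ) t => g l t * term m g n l t)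
        (u := fun y => y) (by simp only [Function.uncurry_def]; fun_prop) continuous_id)
    (hu.mul_left K) (fun n y hy => by
      have := intervalIntegral.norm_integral_le_of_norm_le_const (a := (0 : ℝ)) (b := 1)
        (f := fun r => g l (r * y) * term m g n l (r * y)) (C := K * u n) (by
          intro r hr
          rw [uIoc_of_le zero_le_one] at hr
          have hry := mul_mem_Icc_neg ⟨hr.1.le, hr.2⟩ hy
          rw [norm_mul]
          exact mul_le_mul (hK _ hry) (hb.self_of_nhds n _ hry) (norm_nonneg _)
            ((norm_nonneg _).trans (hK _ hry)))
      simpa using this)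
    hfl
  have h3 := (hasSum_nat_add_iff' 1).2 (hasSum_sol hm hg l x)
  have h4 : HasSum (fun n => term m g (n + 1) l x)
      (-(x * ∫ s in (0 : ℝ)..1, m l (s * x) * flux m g l (s * x))) :=
    ((h2.mul_left x).neg)
  have h5 := h3.unique h4
  rw [intervalIntegral.mul_integral_comp_mul_right (f := fun t => m l t * flux m g l t)] at h5
  simp only [Finset.range_one, Finset.sum_singleton, term, zero_mul, one_mul] at h5
  linarith

theorem hasDerivAt_sol (hm : Continuous (Function.uncurry m))
    (hg : Continuous (Function.uncurry g)) (l : Λ) (x : ℝ) :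
    HasDerivAt (sol m g l) (-(m l x * flux m g l x)) x := by
  have hml : Continuous (m l) := hm.comp (Continuous.prodMk_right l)
  have hfl : Continuous (flux m g l) := (continuous_flux hm hg).comp (Continuous.prodMk_right l)
  have h := ((hml.mul hfl).integral_hasStrictDerivAt 0 x).hasDerivAt.const_sub 1
  exact h.congr_of_eventuallyEq (Eventually.of_forall fun y => sol_eq hm hg l y)

theorem hasDerivAt_flux (hm : Continuous (Function.uncurry m))
    (hg : Continuous (Function.uncurry g)) (l : Λ) (x : ℝ) :
    HasDerivAt (fun x => x * flux m g l x) (g l x * sol m g l x) x := by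
  have hgl : Continuous (g l) := hg.comp (Continuous.prodMk_right l)
  have hsl : Continuous (sol m g l) := (continuous_sol hm hg).comp (Continuous.prodMk_right l)
  have h := ((hgl.mul hsl).integral_hasStrictDerivAt 0 x).hasDerivAt
  refine h.congr_of_eventuallyEq (Eventually.of_forall fun y => ?_)
  simp only [flux]
  rw [intervalIntegral.mul_integral_comp_mul_right (f := fun t => g l t * sol m g l t)]
  simp

theorem sol_zero (hm : Continuous (Function.uncurry m)) (hg : Continuous (Function.uncurry g))
    (l : Λ) : sol m g l 0 = 1 := by
  simp [sol_eq hm hg]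

end Volterra

end SingularSL

/-! ### The Prüfer angle of a regular solution -/

namespace SingularSL

/-- `w` with flux `x U` is the regular solution of `w' = -m U`, `(x U)' = g w` on `(0, 1]`. -/
structure IsSol (m g w U : ℝ → ℝ) : Prop where
  cont_m : Continuous m
  cont_g : Continuous g
  cont_w : Continuous w
  cont_U : Continuous U
  w_zero : w 0 = 1
  deriv_w : ∀ x ∈ Ioc (0 : ℝ) 1, HasDerivAt w (-(m x * U x)) x
  deriv_flux : ∀ x ∈ Ioc (0 : ℝ) 1, HasDerivAt (fun x => x * U x) (g x * w x) x

/-- The projection of the line onto `[0, 1]`. -/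
noncomputable def clamp (x : ℝ) : ℝ := max 0 (min x 1)

theorem continuous_clamp : Continuous clamp := by unfold clamp; fun_prop

theorem clamp_mem (x : ℝ) : clamp x ∈ Icc (0 : ℝ) 1 :=
  ⟨le_max_left _ _, max_le zero_le_one (min_le_right _ _)⟩

theorem clamp_of_mem {x : ℝ} (hx : x ∈ Icc (0 : ℝ) 1) : clamp x = x := by
  rw [clamp, min_eq_left hx.2, max_eq_right hx.1]

/-- The derivative of the Prüfer angle. -/
noncomputable def rate (m g w U : ℝ → ℝ) (x : ℝ) : ℝ :=
  (g x * w x ^ 2 + m x * x * U x ^ 2) / (w x ^ 2 + (x * U x) ^ 2)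

/-- The Prüfer angle. -/
noncomputable def angle (m g w U : ℝ → ℝ) (x : ℝ) : ℝ :=
  ∫ t in (0 : ℝ)..x, rate m g w U (clamp t)

/-- A solution of a linear first-order system vanishing at one point vanishes afterwards. -/
theorem eq_zero_of_system {u v u' v' : ℝ → ℝ} {K a b : ℝ}
    (hu : ContinuousOn u (Icc a b)) (hv : ContinuousOn v (Icc a b))
    (hu' : ∀ x ∈ Ico a b, HasDerivWithinAt u (u' x) (Ici x) x)
    (hv' : ∀ x ∈ Ico a b, HasDerivWithinAt v (v' x) (Ici x) x)
    (hua : u a = 0) (hva : v a = 0)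
    (hub : ∀ x ∈ Ico a b, |u' x| ≤ K * |v x|) (hvb : ∀ x ∈ Ico a b, |v' x| ≤ K * |u x|) :
    ∀ x ∈ Icc a b, u x = 0 ∧ v x = 0 := by
  intro x hx
  have key := eq_zero_of_abs_deriv_le_mul_abs_self_of_eq_zero_right (f := fun x => (u x, v x))
    (f' := fun x => (u' x, v' x)) (K := |K|) (hu.prodMk hv)
    (fun y hy => (hu' y hy).prodMk (hv' y hy)) (by simp [hua, hva])
    (fun y hy => by
      rw [Prod.norm_def, Prod.norm_def]
      simp only [Real.norm_eq_abs]
      refine max_le ((hub y hy).trans ?_) ((hvb y hy).trans ?_)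
      · exact mul_le_mul (le_abs_self K) (le_max_right _ _) (abs_nonneg _) (abs_nonneg _)
      · exact mul_le_mul (le_abs_self K) (le_max_left _ _) (abs_nonneg _) (abs_nonneg _)) x hx
  simpa using key

theorem hasDerivAt_integrating_factor {δ φ : ℝ → ℝ} (hφ : Continuous φ) {c x : ℝ}
    (hδ : HasDerivAt δ (φ x * δ x + c) x) :
    HasDerivAt (fun x => Real.exp (-∫ t in (0 : ℝ)..x, φ t) * δ x)
      (Real.exp (-∫ t in (0 : ℝ)..x, φ t) * c) x := by
  have h := ((hφ.integral_hasStrictDerivAt 0 x).hasDerivAt.neg.exp).mul hδ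
  refine h.congr_deriv ?_
  simp
  ring

theorem continuous_integrating_factor {φ : ℝ → ℝ} (hφ : Continuous φ) :
    Continuous fun x => Real.exp (-∫ t in (0 : ℝ)..x, φ t) :=
  Real.continuous_exp.comp (continuous_iff_continuousAt.2 fun x =>
    (hφ.integral_hasStrictDerivAt 0 x).hasDerivAt.continuousAt).neg

/-- The integrating factor `exp (-∫ φ)` turns `δ` into a monotone function starting at `0`. -/
theorem nonneg_of_hasDerivAt_mul_add {δ φ f : ℝ → ℝ} (hφ : Continuous φ) (hδ : Continuous δ)
    (h0 : δ 0 = 0) (hd : ∀ x ∈ Ioo (0 : ℝ) 1, HasDerivAt δ (φ x * δ x + f x) x)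
    (hf : ∀ x ∈ Ioo (0 : ℝ) 1, 0 ≤ f x) {x : ℝ} (hx : x ∈ Icc (0 : ℝ) 1) : 0 ≤ δ x := by
  have hmono : MonotoneOn (fun x => Real.exp (-∫ t in (0 : ℝ)..x, φ t) * δ x) (Icc 0 1) := by
    refine monotoneOn_of_hasDerivWithinAt_nonneg (convex_Icc 0 1)
      (f' := fun x => Real.exp (-∫ t in (0 : ℝ)..x, φ t) * f x)
      ((continuous_integrating_factor hφ).mul hδ).continuousOn (fun y hy => ?_) (fun y hy => ?_)
    · rw [interior_Icc] at hy
      exact (hasDerivAt_integrating_factor hφ (hd y hy)).hasDerivWithinAt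
    · rw [interior_Icc] at hy
      exact mul_nonneg (Real.exp_pos _).le (hf y hy)
  have h1 := hmono (left_mem_Icc.2 zero_le_one) hx hx.1
  simp only [h0, mul_zero] at h1
  exact nonneg_of_mul_nonneg_right h1 (Real.exp_pos _)

theorem pos_of_hasDerivAt_mul_add {δ φ f : ℝ → ℝ} (hφ : Continuous φ) (hδ : Continuous δ)
    (h0 : δ 0 = 0) (hd : ∀ x ∈ Ioo (0 : ℝ) 1, HasDerivAt δ (φ x * δ x + f x) x)
    (hf : ∀ x ∈ Ioo (0 : ℝ) 1, 0 ≤ f x) (hf' : ∀ᶠ x in 𝓝[>] (0 : ℝ), 0 < f x) : 0 < δ 1 := by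
  obtain ⟨b, hb0, hb⟩ := mem_nhdsGT_iff_exists_Ioo_subset.1 hf'
  set c := min b 1
  have hc0 : 0 < c := lt_min hb0 one_pos
  have hstrict : StrictMonoOn (fun x => Real.exp (-∫ t in (0 : ℝ)..x, φ t) * δ x) (Icc 0 c) := by
    refine strictMonoOn_of_hasDerivWithinAt_pos (convex_Icc 0 c)
      (f' := fun x => Real.exp (-∫ t in (0 : ℝ)..x, φ t) * f x)
      ((continuous_integrating_factor hφ).mul hδ).continuousOn (fun y hy => ?_) (fun y hy => ?_)
    · rw [interior_Icc] at hy
      exact (hasDerivAt_integrating_factor hφ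
        (hd y ⟨hy.1, hy.2.trans_le (min_le_right _ _)⟩)).hasDerivWithinAt
    · rw [interior_Icc] at hy
      exact mul_pos (Real.exp_pos _) (hb ⟨hy.1, hy.2.trans_le (min_le_left _ _)⟩)
  have hmono : MonotoneOn (fun x => Real.exp (-∫ t in (0 : ℝ)..x, φ t) * δ x) (Icc 0 1) := by
    refine monotoneOn_of_hasDerivWithinAt_nonneg (convex_Icc 0 1)
      (f' := fun x => Real.exp (-∫ t in (0 : ℝ)..x, φ t) * f x)
      ((continuous_integrating_factor hφ).mul hδ).continuousOn (fun y hy => ?_) (fun y hy => ?_)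
    · rw [interior_Icc] at hy
      exact (hasDerivAt_integrating_factor hφ (hd y hy)).hasDerivWithinAt
    · rw [interior_Icc] at hy
      exact mul_nonneg (Real.exp_pos _).le (hf y hy)
  have h1 := hstrict (left_mem_Icc.2 hc0.le) (right_mem_Icc.2 hc0.le) hc0
  have h2 := hmono ⟨hc0.le, min_le_right _ _⟩ (right_mem_Icc.2 zero_le_one) (min_le_right _ _)
  simp only [h0, mul_zero] at h1
  exact pos_of_mul_pos_right (h1.trans_le h2) (Real.exp_pos _).le

namespace IsSol

variable {m g w U : ℝ → ℝ}

/-- Away from `x = 0` the system is regular. If `w` and the flux vanished together at `x`,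
uniqueness run backwards from `x` would give `w = 0` at a point `ε` so close to `0` that `w ε > 0`.
-/
theorem sq_add_sq_pos (h : IsSol m g w U) {x : ℝ} (hx : x ∈ Icc (0 : ℝ) 1) :
    0 < w x ^ 2 + (x * U x) ^ 2 := by
  rcases hx.1.eq_or_lt with rfl | hx0
  · simp [h.w_zero]
  by_contra hneg
  have h0 : w x ^ 2 + (x * U x) ^ 2 = 0 := le_antisymm (not_lt.1 hneg) (by positivity)
  have hw0 : w x = 0 := by nlinarith [sq_nonneg (w x), sq_nonneg (x * U x)]
  have hU0 : x * U x = 0 := by nlinarith [sq_nonneg (w x), sq_nonneg (x * U x)]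
  obtain ⟨ε, hε, hεx, hwε⟩ : ∃ ε, 0 < ε ∧ ε < x ∧ w ε ≠ 0 := by
    have h1 : ∀ᶠ y in 𝓝[>] (0 : ℝ), 0 < w y :=
      (h.cont_w.continuousAt.eventually_const_lt (by rw [h.w_zero]; exact one_pos)).filter_mono
        nhdsWithin_le_nhds
    obtain ⟨ε, h2, h3⟩ := (h1.and (Ioo_mem_nhdsGT hx0)).exists
    exact ⟨ε, h3.1, h3.2, h2.ne'⟩
  obtain ⟨M, hM⟩ := (isCompact_Icc (a := (0 : ℝ)) (b := 1)).exists_bound_of_continuousOn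
    h.cont_m.continuousOn
  obtain ⟨G, hG⟩ := (isCompact_Icc (a := (0 : ℝ)) (b := 1)).exists_bound_of_continuousOn
    h.cont_g.continuousOn
  have hmem : ∀ t ∈ Icc 0 (x - ε), x - t ∈ Ioc (0 : ℝ) 1 ∧ ε ≤ x - t := fun t ht =>
    ⟨⟨by linarith [ht.2], by linarith [ht.1, hx.2]⟩, by linarith [ht.2]⟩
  have hM0 : 0 ≤ M := (norm_nonneg _).trans (hM 0 (by simp))
  have key := eq_zero_of_system (u := fun t => w (x - t)) (v := fun t => (x - t) * U (x - t))
    (u' := fun t => m (x - t) * U (x - t)) (v' := fun t => -(g (x - t) * w (x - t)))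
    (K := max (M / ε) G) (a := 0) (b := x - ε)
    (by have := h.cont_w; fun_prop) (by have := h.cont_U; fun_prop)
    (fun t ht => by
      have := (h.deriv_w _ (hmem t ⟨ht.1, ht.2.le⟩).1).scomp t ((hasDerivAt_id t).const_sub x)
      simpa [Function.comp_def] using this.hasDerivWithinAt)
    (fun t ht => by
      have := (h.deriv_flux _ (hmem t ⟨ht.1, ht.2.le⟩).1).scomp t
        ((hasDerivAt_id t).const_sub x)
      simpa [Function.comp_def] using this.hasDerivWithinAt)
    (by simpa using hw0) (by simpa using hU0)
    (fun t ht => by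
      obtain ⟨h1, h2⟩ := hmem t ⟨ht.1, ht.2.le⟩
      have h3 := hM _ ⟨h1.1.le, h1.2⟩
      rw [Real.norm_eq_abs] at h3
      rw [abs_mul, abs_mul, abs_of_pos h1.1]
      have h4 : M ≤ max (M / ε) G * (x - t) := by
        calc M = M / ε * ε := by field_simp
          _ ≤ max (M / ε) G * (x - t) :=
            mul_le_mul (le_max_left _ _) h2 hε.le
              (le_trans (by positivity) (le_max_left _ _))
      calc |m (x - t)| * |U (x - t)| ≤ (max (M / ε) G * (x - t)) * |U (x - t)| :=
            mul_le_mul_of_nonneg_right (h3.trans h4) (abs_nonneg _)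
        _ = _ := by ring)
    (fun t ht => by
      obtain ⟨h1, h2⟩ := hmem t ⟨ht.1, ht.2.le⟩
      have h3 := hG _ ⟨h1.1.le, h1.2⟩
      rw [Real.norm_eq_abs] at h3
      rw [abs_neg, abs_mul]
      exact mul_le_mul_of_nonneg_right (h3.trans (le_max_right _ _)) (abs_nonneg _))
    (x - ε) ⟨by linarith, le_rfl⟩
  apply hwε
  simpa using key.1

theorem continuous_rate (h : IsSol m g w U) : Continuous fun x => rate m g w U (clamp x) := by
  have h1 := h.cont_m
  have h2 := h.cont_g
  have h3 := h.cont_w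
  have h4 := h.cont_U
  have h5 := continuous_clamp
  unfold rate
  exact Continuous.div (by fun_prop) (by fun_prop) fun x => (h.sq_add_sq_pos (clamp_mem x)).ne'

theorem angle_zero : angle m g w U 0 = 0 := by simp [angle]

theorem hasDerivAt_angle' (h : IsSol m g w U) (x : ℝ) :
    HasDerivAt (angle m g w U) (rate m g w U (clamp x)) x :=
  (h.continuous_rate.integral_hasStrictDerivAt 0 x).hasDerivAt

theorem hasDerivAt_angle (h : IsSol m g w U) {x : ℝ} (hx : x ∈ Icc (0 : ℝ) 1) :
    HasDerivAt (angle m g w U) (rate m g w U x) x := by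
  have := h.hasDerivAt_angle' x
  rwa [clamp_of_mem hx] at this

theorem continuous_angle (h : IsSol m g w U) : Continuous (angle m g w U) :=
  continuous_iff_continuousAt.2 fun x => (h.hasDerivAt_angle' x).continuousAt

/-- The Prüfer radius. -/
noncomputable def radius (m g w U : ℝ → ℝ) (x : ℝ) : ℝ :=
  w x * Real.cos (angle m g w U x) + x * U x * Real.sin (angle m g w U x)

theorem continuous_radius (h : IsSol m g w U) : Continuous (radius m g w U) := by
  have h3 := h.cont_w
  have h4 := h.cont_U
  have h5 := h.continuous_angle
  unfold radius
  fun_prop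

/-- This shows that the integral defining `angle` really is the argument of `(w, x U)`. The
expression solves a homogeneous linear equation and vanishes at `0`; its coefficient stays
continuous at `0` because the factor `m / x` only meets `x U`. -/
theorem phase_eq_zero (h : IsSol m g w U) {x : ℝ} (hx : x ∈ Icc (0 : ℝ) 1) :
    w x * Real.sin (angle m g w U x) - x * U x * Real.cos (angle m g w U x) = 0 := by
  have h1 := h.cont_m
  have h2 := h.cont_g
  have h3 := h.cont_w
  have h4 := h.cont_U
  have h5 := h.continuous_angle
  set θ := angle m g w U with hθ
  have hderiv : ∀ x ∈ Ioc (0 : ℝ) 1,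
      HasDerivAt (fun x => w x * Real.sin (θ x) - x * U x * Real.cos (θ x))
        (w x * (g x * (x * U x) - m x * U x) / (w x ^ 2 + (x * U x) ^ 2) *
          (w x * Real.sin (θ x) - x * U x * Real.cos (θ x))) x := by
    intro x hx
    have hθ' := h.hasDerivAt_angle ⟨hx.1.le, hx.2⟩
    have hpos := h.sq_add_sq_pos ⟨hx.1.le, hx.2⟩
    have := ((h.deriv_w x hx).mul hθ'.sin).sub ((h.deriv_flux x hx).mul hθ'.cos)
    refine this.congr_deriv ?_
    simp only [rate, ← hθ]
    generalize hN : w x ^ 2 + (x * U x) ^ 2 = N at hpos ⊢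
    field_simp
    rw [← hN]
    ring
  have hφ : Continuous fun x => w (clamp x) * (g (clamp x) * (clamp x * U (clamp x)) -
      m (clamp x) * U (clamp x)) / (w (clamp x) ^ 2 + (clamp x * U (clamp x)) ^ 2) := by
    have := continuous_clamp
    exact Continuous.div (by fun_prop) (by fun_prop) fun x =>
      (h.sq_add_sq_pos (clamp_mem x)).ne'
  have h6 := nonneg_of_hasDerivAt_mul_add hφ (f := fun _ => 0)
    (δ := fun x => w x * Real.sin (θ x) - x * U x * Real.cos (θ x)) (by fun_prop)
    (by simp [hθ, angle_zero]) (fun y hy => by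
      have := hderiv y ⟨hy.1, hy.2.le⟩
      rw [clamp_of_mem ⟨hy.1.le, hy.2.le⟩, add_zero]
      exact this) (fun _ _ => le_rfl) hx
  have h7 := nonneg_of_hasDerivAt_mul_add hφ (f := fun _ => 0)
    (δ := fun x => -(w x * Real.sin (θ x) - x * U x * Real.cos (θ x))) (by fun_prop)
    (by simp [hθ, angle_zero]) (fun y hy => by
      have := (hderiv y ⟨hy.1, hy.2.le⟩).neg
      rw [clamp_of_mem ⟨hy.1.le, hy.2.le⟩, add_zero, mul_neg]
      exact this) (fun _ _ => le_rfl) hx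
  linarith

theorem radius_sq (h : IsSol m g w U) {x : ℝ} (hx : x ∈ Icc (0 : ℝ) 1) :
    radius m g w U x ^ 2 = w x ^ 2 + (x * U x) ^ 2 := by
  have h1 := h.phase_eq_zero hx
  have h2 := Real.sin_sq_add_cos_sq (angle m g w U x)
  unfold radius
  linear_combination (w x ^ 2 + (x * U x) ^ 2) * h2 -
    (w x * Real.sin (angle m g w U x) - x * U x * Real.cos (angle m g w U x)) * h1

theorem radius_pos (h : IsSol m g w U) {x : ℝ} (hx : x ∈ Icc (0 : ℝ) 1) :
    0 < radius m g w U x := by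
  by_contra hneg
  have h0 : radius m g w U 0 = 1 := by simp [radius, angle_zero, h.w_zero]
  obtain ⟨t, ht, hrt⟩ := intermediate_value_Icc' hx.1 h.continuous_radius.continuousOn
    (show (0 : ℝ) ∈ Icc _ _ from ⟨not_lt.1 hneg, by rw [h0]; exact zero_le_one⟩)
  have ht' : t ∈ Icc (0 : ℝ) 1 := ⟨ht.1, ht.2.trans hx.2⟩
  have h1 := h.radius_sq ht'
  rw [hrt] at h1
  have := h.sq_add_sq_pos ht'
  linarith

theorem w_eq (h : IsSol m g w U) {x : ℝ} (hx : x ∈ Icc (0 : ℝ) 1) :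
    w x = radius m g w U x * Real.cos (angle m g w U x) := by
  have h1 := h.phase_eq_zero hx
  have h2 := Real.sin_sq_add_cos_sq (angle m g w U x)
  unfold radius
  linear_combination -w x * h2 + Real.sin (angle m g w U x) * h1

theorem flux_eq (h : IsSol m g w U) {x : ℝ} (hx : x ∈ Icc (0 : ℝ) 1) :
    x * U x = radius m g w U x * Real.sin (angle m g w U x) := by
  have h1 := h.phase_eq_zero hx
  have h2 := Real.sin_sq_add_cos_sq (angle m g w U x)
  unfold radius
  linear_combination -(x * U x) * h2 - Real.cos (angle m g w U x) * h1

theorem rate_eq (h : IsSol m g w U) {x : ℝ} (hx : x ∈ Ioc (0 : ℝ) 1) :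
    rate m g w U x = g x * Real.cos (angle m g w U x) ^ 2 +
      m x / x * Real.sin (angle m g w U x) ^ 2 := by
  have hx' : x ∈ Icc (0 : ℝ) 1 := ⟨hx.1.le, hx.2⟩
  have h1 := h.radius_sq hx'
  have h2 := h.radius_pos hx'
  have h3 : m x * x * U x ^ 2 = m x / x * (x * U x) ^ 2 := by
    have := hx.1.ne'
    field_simp
  rw [rate, h3, ← h1, h.flux_eq hx']
  nth_rewrite 1 [h.w_eq hx']
  field_simp

end IsSol

end SingularSL

/-! ### Sturm comparison and size of the Prüfer angle. -/

namespace SingularSL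

namespace IsSol

variable {m g w U : ℝ → ℝ}

section Comparison

variable {m₁ g₁ w₁ U₁ m₂ g₂ w₂ U₂ : ℝ → ℝ}

/-- Subtracting the two angle equations leaves a forcing term plus `(m₂ / x - g₂)` times `sin² θ₂ -
sin² θ₁ = sin (θ₂ - θ₁) sin (θ₁ + θ₂)`. The first sine is `sinc (θ₂ - θ₁)` times the difference. In
the second, `sin θ / x = U / R` absorbs the singular `1/x`, so `φ` is continuous up to `0`. -/
theorem hasDerivAt_angle_sub (h₁ : IsSol m₁ g₁ w₁ U₁) (h₂ : IsSol m₂ g₂ w₂ U₂) :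
    ∃ φ : ℝ → ℝ, Continuous φ ∧ ∀ x ∈ Ioo (0 : ℝ) 1,
      HasDerivAt (fun x => angle m₂ g₂ w₂ U₂ x - angle m₁ g₁ w₁ U₁ x)
        (φ x * (angle m₂ g₂ w₂ U₂ x - angle m₁ g₁ w₁ U₁ x) +
          ((m₂ x - m₁ x) / x * Real.sin (angle m₁ g₁ w₁ U₁ x) ^ 2 +
            (g₂ x - g₁ x) * Real.cos (angle m₁ g₁ w₁ U₁ x) ^ 2)) x := by
  set θ₁ := angle m₁ g₁ w₁ U₁ with hθ₁
  set θ₂ := angle m₂ g₂ w₂ U₂ with hθ₂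
  set R₁ := radius m₁ g₁ w₁ U₁ with hR₁
  set R₂ := radius m₂ g₂ w₂ U₂ with hR₂
  have c1 : Continuous θ₁ := h₁.continuous_angle
  have c2 : Continuous θ₂ := h₂.continuous_angle
  have c3 : Continuous R₁ := h₁.continuous_radius
  have c4 : Continuous R₂ := h₂.continuous_radius
  have c5 := h₁.cont_U
  have c6 := h₂.cont_U
  have c7 := h₂.cont_m
  have c8 := h₂.cont_g
  have c9 := continuous_clamp
  have c10 := Real.continuous_sinc
  have p1 : ∀ x, R₁ (clamp x) ≠ 0 := fun x => (h₁.radius_pos (clamp_mem x)).ne'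
  have p2 : ∀ x, R₂ (clamp x) ≠ 0 := fun x => (h₂.radius_pos (clamp_mem x)).ne'
  set ψ : ℝ → ℝ := fun x => (m₂ x - x * g₂ x) *
    (U₁ x / R₁ x * Real.cos (θ₂ x) + Real.cos (θ₁ x) * (U₂ x / R₂ x)) *
    Real.sinc (θ₂ x - θ₁ x) with hψ
  refine ⟨fun x => ψ (clamp x), ?_, fun x hx => ?_⟩
  · have d1 : Continuous fun x => U₁ (clamp x) / R₁ (clamp x) :=
      Continuous.div (by fun_prop) (by fun_prop) p1
    have d2 : Continuous fun x => U₂ (clamp x) / R₂ (clamp x) :=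
      Continuous.div (by fun_prop) (by fun_prop) p2
    simp only [hψ]
    fun_prop
  · have hx' : x ∈ Icc (0 : ℝ) 1 := ⟨hx.1.le, hx.2.le⟩
    have hx'' : x ∈ Ioc (0 : ℝ) 1 := ⟨hx.1, hx.2.le⟩
    have hd := (h₂.hasDerivAt_angle hx').sub (h₁.hasDerivAt_angle hx')
    refine hd.congr_deriv ?_
    rw [h₁.rate_eq hx'', h₂.rate_eq hx'']
    simp only [clamp_of_mem hx', hψ]
    have q1 := (h₁.radius_pos hx').ne'
    have q2 := (h₂.radius_pos hx').ne'
    have e1 : U₁ x / R₁ x = Real.sin (θ₁ x) / x := by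
      rw [div_eq_div_iff q1 hx.1.ne', mul_comm, h₁.flux_eq hx', mul_comm]
    have e2 : U₂ x / R₂ x = Real.sin (θ₂ x) / x := by
      rw [div_eq_div_iff q2 hx.1.ne', mul_comm, h₂.flux_eq hx', mul_comm]
    have e3 : Real.sinc (θ₂ x - θ₁ x) * (θ₂ x - θ₁ x) = Real.sin (θ₂ x - θ₁ x) := by
      by_cases h0 : θ₂ x - θ₁ x = 0
      · simp [h0]
      · rw [Real.sinc_of_ne_zero h0, div_mul_cancel₀ _ h0]
    rw [e1, e2, mul_assoc _ (Real.sinc _) _, e3, Real.sin_sub]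
    have s1 := Real.sin_sq_add_cos_sq (θ₁ x)
    have s2 := Real.sin_sq_add_cos_sq (θ₂ x)
    have hx0 := hx.1.ne'
    have e4 : Real.cos (θ₁ x) ^ 2 = 1 - Real.sin (θ₁ x) ^ 2 := by linarith
    have e5 : Real.cos (θ₂ x) ^ 2 = 1 - Real.sin (θ₂ x) ^ 2 := by linarith
    field_simp
    linear_combination (exp := 1) (m₂ x - x * g₂ x) *
      (Real.sin (θ₂ x) ^ 2 * e4 - Real.sin (θ₁ x) ^ 2 * e5) * (-1) +
      x * g₂ x * (e5 - e4)

theorem angle_le (h₁ : IsSol m₁ g₁ w₁ U₁) (h₂ : IsSol m₂ g₂ w₂ U₂)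
    (hm : ∀ x ∈ Ioo (0 : ℝ) 1, m₁ x ≤ m₂ x) (hg : ∀ x ∈ Ioo (0 : ℝ) 1, g₁ x ≤ g₂ x) {x : ℝ}
    (hx : x ∈ Icc (0 : ℝ) 1) : angle m₁ g₁ w₁ U₁ x ≤ angle m₂ g₂ w₂ U₂ x := by
  obtain ⟨φ, hφ, hd⟩ := h₁.hasDerivAt_angle_sub h₂
  refine sub_nonneg.1 (nonneg_of_hasDerivAt_mul_add hφ
    (h₂.continuous_angle.sub h₁.continuous_angle) (by simp [angle_zero]) hd (fun y hy => ?_) hx)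
  have a1 := sub_nonneg.2 (hm y hy)
  have a2 := sub_nonneg.2 (hg y hy)
  have a3 := hy.1.le
  positivity

/-- Strictness is gained near `x = 0`, where `θ₁` is small and so `cos θ₁ > 0` makes the forcing
positive. -/
theorem angle_lt (h₁ : IsSol m₁ g₁ w₁ U₁) (h₂ : IsSol m₂ g₂ w₂ U₂)
    (hm : ∀ x ∈ Ioo (0 : ℝ) 1, m₁ x ≤ m₂ x) (hg : ∀ x ∈ Ioo (0 : ℝ) 1, g₁ x < g₂ x) :
    angle m₁ g₁ w₁ U₁ 1 < angle m₂ g₂ w₂ U₂ 1 := by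
  obtain ⟨φ, hφ, hd⟩ := h₁.hasDerivAt_angle_sub h₂
  refine sub_pos.1 (pos_of_hasDerivAt_mul_add hφ
    (h₂.continuous_angle.sub h₁.continuous_angle) (by simp [angle_zero]) hd (fun y hy => ?_) ?_)
  · have a1 := sub_nonneg.2 (hm y hy)
    have a2 := sub_nonneg.2 (hg y hy).le
    have a3 := hy.1.le
    positivity
  · have hc : ∀ᶠ y in 𝓝 (0 : ℝ), 0 < Real.cos (angle m₁ g₁ w₁ U₁ y) :=
      (Real.continuous_cos.comp h₁.continuous_angle).continuousAt.eventually_const_lt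
        (by simp [angle_zero])
    filter_upwards [hc.filter_mono nhdsWithin_le_nhds, Ioo_mem_nhdsGT one_pos] with y h1 hy
    have a1 := sub_nonneg.2 (hm y hy)
    have a2 := sub_pos.2 (hg y hy)
    have a3 := hy.1.le
    positivity

end Comparison

/-- A barrier argument: when the angle equals `-π/2`, its derivative is `m / x > 0` whatever the
sign of `g`. -/
theorem neg_pi_div_two_le_angle (h : IsSol m g w U) (hm : ∀ x ∈ Ioc (0 : ℝ) 1, 0 < m x) {x : ℝ}
    (hx : x ∈ Icc (0 : ℝ) 1) : -(Real.pi / 2) ≤ angle m g w U x := by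
  have key := image_le_of_deriv_right_lt_deriv_boundary (f := fun x => -angle m g w U x)
    (f' := fun x => -rate m g w U x) (a := 0) (b := 1) (B := fun _ => Real.pi / 2)
    (B' := fun _ => 0) h.continuous_angle.neg.continuousOn
    (fun y hy => (h.hasDerivAt_angle ⟨hy.1, hy.2.le⟩).neg.hasDerivWithinAt)
    (by simp only [angle_zero]; linarith [Real.pi_pos]) (fun _ => hasDerivAt_const _ _)
    (fun y hy hy2 => by
      rcases hy.1.eq_or_lt with rfl | hy0
      · simp only [angle_zero] at hy2
        linarith [Real.pi_pos]
      · have hy' : y ∈ Ioc (0 : ℝ) 1 := ⟨hy0, hy.2.le⟩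
        have e : angle m g w U y = -(Real.pi / 2) := by linarith
        rw [h.rate_eq hy', e]
        have := div_pos (hm y hy') hy0
        simpa using this) hx
  linarith

theorem rate_nonneg (hm : ∀ x ∈ Icc (0 : ℝ) 1, 0 ≤ m x)
    (hg : ∀ x ∈ Icc (0 : ℝ) 1, 0 ≤ g x) {x : ℝ} (hx : x ∈ Icc (0 : ℝ) 1) :
    0 ≤ rate m g w U x := by
  have a1 := hm x hx
  have a2 := hg x hx
  have a3 := hx.1
  unfold rate
  positivity

theorem monotoneOn_angle (h : IsSol m g w U) (hm : ∀ x ∈ Icc (0 : ℝ) 1, 0 ≤ m x)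
    (hg : ∀ x ∈ Icc (0 : ℝ) 1, 0 ≤ g x) : MonotoneOn (angle m g w U) (Icc 0 1) := by
  refine monotoneOn_of_hasDerivWithinAt_nonneg (convex_Icc 0 1) (f' := rate m g w U)
    h.continuous_angle.continuousOn (fun y hy => ?_) (fun y hy => ?_)
  · exact (h.hasDerivAt_angle (interior_subset hy)).hasDerivWithinAt
  · exact rate_nonneg hm hg (interior_subset hy)

/-- The angle grows at least linearly where both coefficients are bounded below. -/
theorem mul_le_angle (h : IsSol m g w U) (hm : ∀ x ∈ Icc (0 : ℝ) 1, 0 ≤ m x)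
    (hg : ∀ x ∈ Icc (0 : ℝ) 1, 0 ≤ g x) {C α : ℝ} (hα : α ∈ Icc (0 : ℝ) 1) (hC : 0 ≤ C)
    (hmC : ∀ x ∈ Icc α 1, C ≤ m x) (hgC : ∀ x ∈ Icc α 1, C ≤ g x) :
    C * (1 - α) ≤ angle m g w U 1 := by
  have h0 := h.monotoneOn_angle hm hg (left_mem_Icc.2 zero_le_one) hα hα.1
  rw [angle_zero] at h0
  have hmono : MonotoneOn (fun x => angle m g w U x - C * x) (Icc α 1) := by
    refine monotoneOn_of_hasDerivWithinAt_nonneg (convex_Icc α 1)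
      (f' := fun x => rate m g w U x - C)
      (h.continuous_angle.sub (by fun_prop)).continuousOn (fun y hy => ?_) (fun y hy => ?_)
    · have hy' : y ∈ Icc α 1 := interior_subset hy
      have := (h.hasDerivAt_angle ⟨hα.1.trans hy'.1, hy'.2⟩).sub ((hasDerivAt_id y).const_mul C)
      exact (this.congr_deriv (by simp)).hasDerivWithinAt
    · have hy' : y ∈ Icc α 1 := interior_subset hy
      have hy01 : y ∈ Icc (0 : ℝ) 1 := ⟨hα.1.trans hy'.1, hy'.2⟩
      have a0 := h.sq_add_sq_pos hy01
      have a1 := mul_le_mul_of_nonneg_right (hgC y hy') (sq_nonneg (w y))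
      have a2 : C * (y * U y) ^ 2 ≤ m y * y * U y ^ 2 := by
        have b1 : C * y ≤ m y := by nlinarith [hmC y hy', hy01.1, hy01.2]
        have b2 := mul_le_mul_of_nonneg_right b1 (mul_nonneg hy01.1 (sq_nonneg (U y)))
        nlinarith
      rw [sub_nonneg, rate, le_div_iff₀ a0]
      linarith
  have h1 := hmono (left_mem_Icc.2 hα.2) (right_mem_Icc.2 hα.2) hα.2
  simp only at h1
  linarith

/-- For large `λ` only `g` is large; choosing `σ = √λ` balances the coefficients so that both have
order `√λ`. -/
theorem scale (h : IsSol m g w U) {σ : ℝ} (hσ : 0 < σ) :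
    IsSol (fun x => σ * m x) (fun x => g x / σ) w (fun x => U x / σ) where
  cont_m := h.cont_m.const_mul σ
  cont_g := h.cont_g.div_const σ
  cont_w := h.cont_w
  cont_U := h.cont_U.div_const σ
  w_zero := h.w_zero
  deriv_w x hx := (h.deriv_w x hx).congr_deriv (by field_simp)
  deriv_flux x hx := by
    have := (h.deriv_flux x hx).div_const σ
    refine (this.congr_deriv (by ring)).congr_of_eventuallyEq (Eventually.of_forall fun y => ?_)
    simp only
    ring

theorem abs_lt_pi_div_two {f : ℝ → ℝ} (hf : Continuous f) (h0 : f 0 = 0) {b : ℝ} (hb : 0 ≤ b)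
    (hcos : ∀ x ∈ Icc (0 : ℝ) b, 0 < Real.cos (f x)) : |f b| < Real.pi / 2 := by
  by_contra hneg
  obtain ⟨t, ht, hft⟩ := intermediate_value_Icc hb hf.abs.continuousOn
    (show Real.pi / 2 ∈ Icc _ _ from ⟨by rw [h0, abs_zero]; positivity, not_lt.1 hneg⟩)
  have h1 := hcos t ht
  simp only at hft
  rw [← Real.cos_abs, hft, Real.cos_pi_div_two] at h1
  exact lt_irrefl _ h1

/-- The vectors `(w, x U)` and `(w, x U / σ)` have positive inner product at every `x`, so the
cosine of the angle difference never vanishes and the difference, starting at `0`, cannot reach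
`±π/2`. -/
theorem abs_angle_scale_sub_lt (h : IsSol m g w U) {σ : ℝ} (hσ : 0 < σ) :
    |angle (fun x => σ * m x) (fun x => g x / σ) w (fun x => U x / σ) 1 - angle m g w U 1|
      < Real.pi / 2 := by
  have hs := h.scale hσ
  refine abs_lt_pi_div_two (f := fun x => angle (fun x => σ * m x) (fun x => g x / σ) w
    (fun x => U x / σ) x - angle m g w U x) (hs.continuous_angle.sub h.continuous_angle)
    (by simp [angle_zero]) zero_le_one fun x hx => ?_
  rw [Real.cos_sub]
  have r1 := h.radius_pos hx
  have r2 := hs.radius_pos hx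
  have e1 := h.w_eq hx
  have e2 := hs.w_eq hx
  have e3 := h.flux_eq hx
  have e4 := hs.flux_eq hx
  have hp := h.sq_add_sq_pos hx
  have key : 0 < w x * w x + (x * U x) * (x * (U x / σ)) := by
    have : w x * w x + (x * U x) * (x * (U x / σ)) = w x ^ 2 + (x * U x) ^ 2 / σ := by ring
    rw [this]
    rcases (sq_nonneg (w x)).eq_or_lt with h0 | h0
    · rw [← h0, zero_add] at hp ⊢
      positivity
    · positivity
  have e5 : w x * w x + (x * U x) * (x * (U x / σ)) =
      (radius m g w U x * radius (fun x => σ * m x) (fun x => g x / σ) w (fun x => U x / σ) x) *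
      (Real.cos (angle (fun x => σ * m x) (fun x => g x / σ) w (fun x => U x / σ) x) *
        Real.cos (angle m g w U x) +
        Real.sin (angle (fun x => σ * m x) (fun x => g x / σ) w (fun x => U x / σ) x) *
        Real.sin (angle m g w U x)) := by
    rw [e3, e4]
    nth_rewrite 1 [e1]
    rw [e2]
    ring
  rw [e5] at key
  exact pos_of_mul_pos_right key (mul_pos r1 r2).le

theorem cos_angle_pos_iff (h : IsSol m g w U) {x : ℝ} (hx : x ∈ Icc (0 : ℝ) 1) :
    0 < Real.cos (angle m g w U x) ↔ 0 < w x := by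
  rw [h.w_eq hx, mul_pos_iff_of_pos_left (h.radius_pos hx)]

theorem cos_angle_eq_zero_iff (h : IsSol m g w U) {x : ℝ} (hx : x ∈ Icc (0 : ℝ) 1) :
    Real.cos (angle m g w U x) = 0 ↔ w x = 0 := by
  rw [h.w_eq hx, mul_eq_zero, or_iff_right (h.radius_pos hx).ne']

theorem sin_angle_eq_zero_iff (h : IsSol m g w U) {x : ℝ} (hx : x ∈ Icc (0 : ℝ) 1) :
    Real.sin (angle m g w U x) = 0 ↔ x * U x = 0 := by
  rw [h.flux_eq hx, mul_eq_zero, or_iff_right (h.radius_pos hx).ne']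

/-- A positive regular solution with negative flux at `1` has negative angle there. -/
theorem angle_neg_of_pos (h : IsSol m g w U) (hw : ∀ x ∈ Icc (0 : ℝ) 1, 0 < w x)
    (hU : U 1 < 0) : angle m g w U 1 < 0 := by
  have h1 := abs_lt_pi_div_two h.continuous_angle angle_zero zero_le_one
    fun x hx => (h.cos_angle_pos_iff hx).2 (hw x hx)
  by_contra hneg
  have h2 := h.flux_eq (right_mem_Icc.2 zero_le_one)
  have h3 := Real.sin_nonneg_of_nonneg_of_le_pi (not_lt.1 hneg)
    (by linarith [(abs_lt.1 h1).2, Real.pi_pos])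
  have h4 := mul_nonneg (h.radius_pos (right_mem_Icc.2 zero_le_one)).le h3
  linarith

/-- A regular solution that is positive on `[0, 1)` and vanishes at `1` has angle `π / 2`. -/
theorem angle_eq_pi_div_two (h : IsSol m g w U) (hm : ∀ x ∈ Icc (0 : ℝ) 1, 0 ≤ m x)
    (hg : ∀ x ∈ Icc (0 : ℝ) 1, 0 ≤ g x) (hw : ∀ x ∈ Ico (0 : ℝ) 1, 0 < w x) (hw1 : w 1 = 0) :
    angle m g w U 1 = Real.pi / 2 := by
  have h01 : (1 : ℝ) ∈ Icc (0 : ℝ) 1 := right_mem_Icc.2 zero_le_one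
  have h1 : ∀ x ∈ Ico (0 : ℝ) 1, |angle m g w U x| < Real.pi / 2 := fun x hx =>
    abs_lt_pi_div_two h.continuous_angle angle_zero hx.1 fun y hy =>
      (h.cos_angle_pos_iff ⟨hy.1, hy.2.trans hx.2.le⟩).2 (hw y ⟨hy.1, hy.2.trans_lt hx.2⟩)
  have h2 : angle m g w U 1 ≤ Real.pi / 2 := by
    refine le_of_tendsto (h.continuous_angle.continuousAt.tendsto.mono_left
      (nhdsWithin_le_nhds (s := Iio 1))) ?_
    filter_upwards [Ioo_mem_nhdsLT (zero_lt_one' ℝ)] with x hx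
    exact (abs_lt.1 (h1 x ⟨hx.1.le, hx.2⟩)).2.le
  have h3 := h.monotoneOn_angle hm hg (left_mem_Icc.2 zero_le_one) h01 zero_le_one
  rw [angle_zero] at h3
  refine h2.antisymm (not_lt.1 fun h4 => ?_)
  have h5 := Real.cos_pos_of_mem_Ioo (x := angle m g w U 1) ⟨by linarith [Real.pi_pos], h4⟩
  rw [(h.cos_angle_eq_zero_iff h01).2 hw1] at h5
  exact lt_irrefl _ h5

end IsSol

/-! ### Continuity of the angle in the parameters. -/

section Parameters

variable {Λ : Type*} [TopologicalSpace Λ] {m g : Λ → ℝ → ℝ}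

theorem isSol_sol (hm : Continuous (Function.uncurry m)) (hg : Continuous (Function.uncurry g))
    (l : Λ) : IsSol (m l) (g l) (sol m g l) (flux m g l) where
  cont_m := hm.comp (Continuous.prodMk_right l)
  cont_g := hg.comp (Continuous.prodMk_right l)
  cont_w := (continuous_sol hm hg).comp (Continuous.prodMk_right l)
  cont_U := (continuous_flux hm hg).comp (Continuous.prodMk_right l)
  w_zero := sol_zero hm hg l
  deriv_w x _ := hasDerivAt_sol hm hg l x
  deriv_flux x _ := hasDerivAt_flux hm hg l x

theorem continuous_angle_sol (hm : Continuous (Function.uncurry m))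
    (hg : Continuous (Function.uncurry g)) :
    Continuous fun l => angle (m l) (g l) (sol m g l) (flux m g l) 1 := by
  refine intervalIntegral.continuous_parametric_intervalIntegral_of_continuous'
    (f := fun l t => rate (m l) (g l) (sol m g l) (flux m g l) (clamp t)) ?_ 0 1
  have hc : Continuous fun y : Λ × ℝ => (y.1, clamp y.2) :=
    continuous_fst.prodMk (continuous_clamp.comp continuous_snd)
  have h1 : Continuous fun y : Λ × ℝ => m y.1 (clamp y.2) := hm.comp hc
  have h2 : Continuous fun y : Λ × ℝ => g y.1 (clamp y.2) := hg.comp hc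
  have h3 : Continuous fun y : Λ × ℝ => sol m g y.1 (clamp y.2) := (continuous_sol hm hg).comp hc
  have h4 : Continuous fun y : Λ × ℝ => flux m g y.1 (clamp y.2) :=
    (continuous_flux hm hg).comp hc
  have h5 := continuous_clamp
  simp only [Function.uncurry_def, rate]
  exact Continuous.div (by fun_prop) (by fun_prop) fun y =>
    ((isSol_sol hm hg y.1).sq_add_sq_pos (clamp_mem y.2)).ne'

end Parameters

end SingularSL

/-! ### The rotation angle of the ellipsoid problem -/

namespace EllipsoidSL

open SingularSL

/-- The projection of `1 - x` onto `[-1/2, 1]`. -/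
noncomputable def yc (x : ℝ) : ℝ := max (-1 / 2) (min (1 - x) 1)

theorem continuous_yc : Continuous yc := by unfold yc; fun_prop

theorem yc_mem (x : ℝ) : yc x ∈ Icc (-1 / 2 : ℝ) 1 :=
  ⟨le_max_left _ _, max_le (by norm_num) (min_le_right _ _)⟩

theorem yc_of_mem {x : ℝ} (hx : x ∈ Icc (0 : ℝ) (3 / 2)) : yc x = 1 - x := by
  rw [yc, min_eq_left (by linarith [hx.1]), max_eq_right (by linarith [hx.2])]

/-- The truncation starts only at `x = 3/2`, so the endpoint `x = 1`, that is `z = 0`, is interior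
and two-sided derivatives are available there. -/
theorem yc_eventuallyEq {x : ℝ} (hx : x ∈ Ioo (0 : ℝ) (3 / 2)) : yc =ᶠ[𝓝 x] fun x => 1 - x := by
  filter_upwards [Ioo_mem_nhds hx.1 hx.2] with t ht
  exact yc_of_mem ⟨ht.1.le, ht.2.le⟩

/-- The quadratic polynomial `β (1 - y²) + y²`. -/
noncomputable def S (β y : ℝ) : ℝ := β * (1 - y ^ 2) + y ^ 2

theorem S_pos {β y : ℝ} (hβ : 0 < β) (hy : y ∈ Icc (-1 : ℝ) 1) : 0 < S β y := by
  unfold S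
  have h1 : 0 ≤ 1 - y ^ 2 := by nlinarith [hy.1, hy.2]
  rcases h1.eq_or_lt with h | h
  · rw [← h]; nlinarith
  · have := mul_pos hβ h
    positivity

theorem S_yc_pos {β : ℝ} (hβ : 0 < β) (x : ℝ) : 0 < S β (yc x) :=
  S_pos hβ ⟨by linarith [(yc_mem x).1], (yc_mem x).2⟩

theorem one_add_yc_pos (x : ℝ) : 0 < 1 + yc x := by linarith [(yc_mem x).1]

theorem one_sub_yc_sq_nonneg (x : ℝ) : 0 ≤ 1 - yc x ^ 2 := by
  nlinarith [(yc_mem x).1, (yc_mem x).2]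

theorem S_le {β y : ℝ} (hβ : 0 < β) (hy : y ∈ Icc (-1 : ℝ) 1) : S β y ≤ β + 1 := by
  unfold S
  have h1 : y ^ 2 ≤ 1 := by nlinarith [hy.1, hy.2]
  nlinarith [sq_nonneg y]

/-- The reciprocal of the regular part of the leading coefficient. -/
noncomputable def coefM (l : Ioi (0 : ℝ) × ℝ) (x : ℝ) : ℝ :=
  1 / ((1 + yc x) * S l.1 (yc x))

/-- The zeroth-order coefficient. -/
noncomputable def coefG (c : ℝ) (l : Ioi (0 : ℝ) × ℝ) (x : ℝ) : ℝ :=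
  c * (1 + 1 / S l.1 (yc x)) + l.2 * ((l.1 : ℝ) ^ 2 * (1 - yc x ^ 2) / S l.1 (yc x) ^ 2)

theorem continuous_S_yc :
    Continuous fun y : (Ioi (0 : ℝ) × ℝ) × ℝ => S y.1.1 (yc y.2) := by
  have := continuous_yc
  unfold S
  fun_prop

theorem continuous_coefM : Continuous (Function.uncurry coefM) := by
  have h1 := continuous_yc
  have h2 := continuous_S_yc
  simp only [Function.uncurry_def, coefM]
  exact Continuous.div (by fun_prop) (by fun_prop) fun y =>
    (mul_pos (one_add_yc_pos _) (S_yc_pos y.1.1.2 _)).ne'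

theorem continuous_coefG (c : ℝ) : Continuous (Function.uncurry (coefG c)) := by
  have h1 := continuous_yc
  have h2 := continuous_S_yc
  have h3 : Continuous fun y : (Ioi (0 : ℝ) × ℝ) × ℝ => 1 / S y.1.1 (yc y.2) :=
    Continuous.div (by fun_prop) (by fun_prop) fun y => (S_yc_pos y.1.1.2 _).ne'
  have h4 : Continuous fun y : (Ioi (0 : ℝ) × ℝ) × ℝ =>
      (y.1.1 : ℝ) ^ 2 * (1 - yc y.2 ^ 2) / S y.1.1 (yc y.2) ^ 2 :=
    Continuous.div (by fun_prop) (by fun_prop) fun y => (pow_pos (S_yc_pos y.1.1.2 _) 2).ne'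
  simp only [Function.uncurry_def, coefG]
  fun_prop

/-- The regular solution of the ellipsoid problem. -/
noncomputable def rsol (c : ℝ) (l : Ioi (0 : ℝ) × ℝ) : ℝ → ℝ := sol coefM (coefG c) l

/-- The rescaled flux of the regular solution. -/
noncomputable def rflux (c : ℝ) (l : Ioi (0 : ℝ) × ℝ) : ℝ → ℝ := flux coefM (coefG c) l

/-- The Prüfer angle of the regular solution at the regular endpoint. -/
noncomputable def Theta (c : ℝ) (l : Ioi (0 : ℝ) × ℝ) : ℝ :=
  angle (coefM l) (coefG c l) (rsol c l) (rflux c l) 1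

theorem isSol_rsol (c : ℝ) (l : Ioi (0 : ℝ) × ℝ) :
    IsSol (coefM l) (coefG c l) (rsol c l) (rflux c l) :=
  isSol_sol continuous_coefM (continuous_coefG c) l

theorem continuous_Theta (c : ℝ) : Continuous (Theta c) :=
  continuous_angle_sol continuous_coefM (continuous_coefG c)

theorem coefM_pos (l : Ioi (0 : ℝ) × ℝ) (x : ℝ) : 0 < coefM l x :=
  one_div_pos.2 (mul_pos (one_add_yc_pos x) (S_yc_pos l.1.2 x))

theorem coefG_nonneg {c : ℝ} (hc : 0 < c) {l : Ioi (0 : ℝ) × ℝ} (hl : 0 ≤ l.2) (x : ℝ) :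
    0 ≤ coefG c l x := by
  have h1 := S_yc_pos l.1.2 x
  have h2 := one_sub_yc_sq_nonneg x
  unfold coefG
  positivity

/-! ### Monotonicity and range of the rotation angle. -/

theorem yc_Ioo {x : ℝ} (hx : x ∈ Ioo (0 : ℝ) 1) : yc x ∈ Ioo (0 : ℝ) 1 := by
  rw [yc_of_mem ⟨hx.1.le, by linarith [hx.2]⟩]
  exact ⟨by linarith [hx.2], by linarith [hx.1]⟩

theorem Theta_strictMono (c : ℝ) (β : Ioi (0 : ℝ)) : StrictMono fun lam => Theta c (β, lam) := by
  intro l₁ l₂ hl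
  refine (isSol_rsol c (β, l₁)).angle_lt (isSol_rsol c (β, l₂)) (fun x _ => le_rfl) fun x hx => ?_
  have h1 := S_yc_pos β.2 x
  have h2 : 0 < 1 - yc x ^ 2 := by nlinarith [(yc_Ioo hx).1, (yc_Ioo hx).2]
  have h3 : (0 : ℝ) < β := β.2
  have h4 : 0 < (β : ℝ) ^ 2 * (1 - yc x ^ 2) / S β (yc x) ^ 2 := by positivity
  unfold coefG
  have := mul_lt_mul_of_pos_right hl h4
  simp only
  linarith

/-- `S` increases with `β`, so at `λ = 0` both coefficients decrease. For `λ > 0` the additional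
term would work in the opposite direction. -/
theorem Theta_strictAnti {c : ℝ} (hc : 0 < c) : StrictAnti fun β => Theta c (β, 0) := by
  intro β₁ β₂ hβ
  refine (isSol_rsol c (β₂, 0)).angle_lt (isSol_rsol c (β₁, 0)) (fun x hx => ?_) fun x hx => ?_
  all_goals
    have h1 := S_yc_pos β₁.2 x
    have h2 : 0 < 1 - yc x ^ 2 := by nlinarith [(yc_Ioo hx).1, (yc_Ioo hx).2]
    have h4 : S β₁ (yc x) < S β₂ (yc x) := by
      unfold S
      have : (β₁ : ℝ) < β₂ := hβ
      nlinarith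
  · have h3 := one_add_yc_pos x
    unfold coefM
    simp only
    gcongr
  · unfold coefG
    simp only [zero_mul, add_zero]
    gcongr

/-- The weak bound at `λ - 1` becomes strict by monotonicity. Strictness matters later: it excludes
the value `-π/2`, at which the cosine vanishes. -/
theorem neg_pi_div_two_lt_Theta (c : ℝ) (β : Ioi (0 : ℝ)) (lam : ℝ) :
    -(Real.pi / 2) < Theta c (β, lam) :=
  ((isSol_rsol c (β, lam - 1)).neg_pi_div_two_le_angle (fun x _ => coefM_pos _ x)
    (right_mem_Icc.2 zero_le_one)).trans_lt (Theta_strictMono c β (by linarith : lam - 1 < lam))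

theorem mul_le_Theta {c : ℝ} (hc : 0 < c) {l : Ioi (0 : ℝ) × ℝ} (hl : 0 ≤ l.2) {C α : ℝ}
    (hα : α ∈ Icc (0 : ℝ) 1) (hC : 0 ≤ C) (hmC : ∀ x ∈ Icc α 1, C ≤ coefM l x)
    (hgC : ∀ x ∈ Icc α 1, C ≤ coefG c l x) : C * (1 - α) ≤ Theta c l :=
  (isSol_rsol c l).mul_le_angle (fun x _ => (coefM_pos l x).le)
    (fun x _ => coefG_nonneg hc hl x) hα hC hmC hgC

theorem le_coefM {l : Ioi (0 : ℝ) × ℝ} {x B : ℝ} (hB : S l.1 (yc x) ≤ B) :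
    1 / (2 * B) ≤ coefM l x := by
  have h1 := S_yc_pos l.1.2 x
  have h2 := one_add_yc_pos x
  have h3 := (yc_mem x).2
  unfold coefM
  gcongr
  linarith

theorem Theta_pos {c : ℝ} (hc : 0 < c) (β : Ioi (0 : ℝ)) : 0 < Theta c (β, 0) := by
  have hβ : (0 : ℝ) < β := β.2
  have hC : 0 < min (1 / (2 * ((β : ℝ) + 1))) c := lt_min (by positivity) hc
  have h := mul_le_Theta hc (l := (β, 0)) le_rfl (left_mem_Icc.2 zero_le_one) hC.le
    (fun x _ => (min_le_left _ _).trans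
      (le_coefM (S_le hβ ⟨by linarith [(yc_mem x).1], (yc_mem x).2⟩)))
    (fun x _ => (min_le_right _ _).trans (by
      have h1 := S_yc_pos hβ x
      simp only [coefG, zero_mul, add_zero]
      have : 0 < 1 / S β (yc x) := by positivity
      nlinarith))
  linarith

/-- Take `β = η²`. On the window `y ≤ η` one has `S ≤ 2η²`, so both coefficients are at least `κ /
(4η²)`; the window has length `η`, so the angle is at least `κ / (4η)`, which is large for small
`η`. -/
theorem exists_lt_Theta_beta {c : ℝ} (hc : 0 < c) (N : ℝ) :
    ∃ β : Ioi (0 : ℝ), N < Theta c (β, 0) := by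
  set κ := min 1 c with hκ
  have hκ0 : 0 < κ := lt_min one_pos hc
  set η := min 1 (κ / (4 * (|N| + 1))) with hη
  have hη0 : 0 < η := lt_min one_pos (by positivity)
  have hη1 : η ≤ 1 := min_le_left _ _
  have hη2 : η ≤ κ / (4 * (|N| + 1)) := min_le_right _ _
  refine ⟨⟨η ^ 2, pow_pos hη0 2⟩, ?_⟩
  have hS : ∀ x ∈ Icc (1 - η) 1, S (η ^ 2) (yc x) ≤ 2 * η ^ 2 := by
    intro x hx
    rw [yc_of_mem ⟨by linarith [hx.1], by linarith [hx.2]⟩]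
    unfold S
    have h1 : (1 - x) ^ 2 ≤ η ^ 2 := by
      have := hx.1
      have := hx.2
      gcongr
      · linarith
    nlinarith [sq_nonneg (1 - x), mul_nonneg (sq_nonneg η) (sq_nonneg (1 - x))]
  have h := mul_le_Theta hc (l := (⟨η ^ 2, pow_pos hη0 2⟩, 0)) le_rfl (α := 1 - η)
    (C := κ / (4 * η ^ 2)) ⟨by linarith, by linarith⟩ (by positivity)
    (fun x hx => le_trans (by
      rw [show 2 * (2 * η ^ 2) = 4 * η ^ 2 by ring]
      gcongr
      exact min_le_left _ _) (le_coefM (hS x hx)))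
    (fun x hx => by
      have h1 := S_yc_pos (pow_pos hη0 2) x
      have h2 := hS x hx
      simp only [coefG, zero_mul, add_zero]
      calc κ / (4 * η ^ 2) ≤ c / (2 * η ^ 2) := by
            gcongr
            · exact min_le_right _ _
            · norm_num
        _ ≤ c / S (η ^ 2) (yc x) := by gcongr
        _ ≤ c * (1 + 1 / S (η ^ 2) (yc x)) := by rw [mul_add, mul_one_div]; linarith)
  refine lt_of_lt_of_le ?_ h
  have h3 : κ / (4 * η ^ 2) * (1 - (1 - η)) = κ / (4 * η) := by field_simp; ring
  rw [h3, lt_div_iff₀ (by positivity)]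
  rw [le_div_iff₀ (by positivity)] at hη2
  nlinarith [le_abs_self N]

/-- With `λ = σ²`, the system scaled by `σ` has both coefficients at least `σ κ` on `[1/2, 1]`,
hence angle at least `σ κ / 2 = |N| + π`. Undoing the scaling costs less than `π/2`. -/
theorem exists_lt_Theta_lam {c : ℝ} (hc : 0 < c) (β : Ioi (0 : ℝ)) (N : ℝ) :
    ∃ lam : ℝ, N < Theta c (β, lam) := by
  have hβ : (0 : ℝ) < β := β.2
  set B := (β : ℝ) + 1 with hB
  have hB0 : 0 < B := by positivity
  set κ := min (1 / (2 * B)) ((β : ℝ) ^ 2 * (3 / 4) / B ^ 2) with hκ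
  have hκ0 : 0 < κ := lt_min (by positivity) (by positivity)
  set σ := 2 * (|N| + Real.pi) / κ with hσ
  have hσ0 : 0 < σ := by have := Real.pi_pos; positivity
  refine ⟨σ ^ 2, ?_⟩
  set l : Ioi (0 : ℝ) × ℝ := (β, σ ^ 2) with hl
  have hs := isSol_rsol c l
  have h := (hs.scale hσ0).mul_le_angle (α := 1 / 2) (C := σ * κ)
    (fun x _ => mul_nonneg hσ0.le (coefM_pos l x).le)
    (fun x _ => div_nonneg (coefG_nonneg hc (sq_nonneg σ) x) hσ0.le)
    ⟨by norm_num, by norm_num⟩ (by positivity)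
    (fun x hx => by
      have : κ ≤ coefM l x := (min_le_left _ _).trans
        (le_coefM (S_le hβ ⟨by linarith [(yc_mem x).1], (yc_mem x).2⟩))
      gcongr)
    (fun x hx => by
      have h1 := S_yc_pos hβ x
      have h2 : S β (yc x) ≤ B := S_le hβ ⟨by linarith [(yc_mem x).1], (yc_mem x).2⟩
      have h3 : (3 / 4 : ℝ) ≤ 1 - yc x ^ 2 := by
        rw [yc_of_mem ⟨by linarith [hx.1], by linarith [hx.2]⟩]
        nlinarith [hx.1, hx.2]
      have h4 : κ ≤ (β : ℝ) ^ 2 * (1 - yc x ^ 2) / S β (yc x) ^ 2 :=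
        (min_le_right _ _).trans (by gcongr)
      rw [le_div_iff₀ hσ0]
      have h5 : 0 ≤ c * (1 + 1 / S β (yc x)) := by positivity
      have h6 := mul_le_mul_of_nonneg_left h4 (sq_nonneg σ)
      simp only [coefG, hl]
      linarith)
  have h7 := (abs_lt.1 (hs.abs_angle_scale_sub_lt hσ0)).2
  have h8 : σ * κ * (1 - 1 / 2) = |N| + Real.pi := by
    rw [hσ]; field_simp; ring
  rw [h8] at h
  have h9 := le_abs_self N
  have h10 := Real.pi_pos
  change N < angle (coefM l) (coefG c l) (rsol c l) (rflux c l) 1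
  linarith

/-- At `β = c` and `λ = 0` the regular solution is the coordinate function `y / √S`. -/
theorem Theta_self (β : Ioi (0 : ℝ)) : Theta β (β, 0) = Real.pi / 2 := by
  have hβ : (0 : ℝ) < β := β.2
  have hc1 := continuous_yc
  have hc2 : Continuous fun x => S β (yc x) := by unfold S; fun_prop
  -- Under the substitution `√S = b / √W`, so `y / √S` is simply `z`; the condition `c = β` means `a
  -- = d`.
  have hsol : IsSol (coefM (β, 0)) (coefG β (β, 0)) (fun x => yc x / √(S β (yc x)))
      (fun x => (1 + yc x) * β / √(S β (yc x))) := by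
    refine ⟨(isSol_rsol β (β, 0)).cont_m, (isSol_rsol β (β, 0)).cont_g, ?_, ?_, ?_, ?_, ?_⟩
    · exact Continuous.div (by fun_prop) (by fun_prop)
        fun x => (Real.sqrt_pos.2 (S_yc_pos hβ x)).ne'
    · exact Continuous.div (by fun_prop) (by fun_prop)
        fun x => (Real.sqrt_pos.2 (S_yc_pos hβ x)).ne'
    · rw [yc_of_mem (by norm_num)]
      simp [S]
    all_goals
      intro x hx
      have hx' : x ∈ Ioo (0 : ℝ) (3 / 2) := ⟨hx.1, by linarith [hx.2]⟩
      have hyx := yc_of_mem ⟨hx'.1.le, hx'.2.le⟩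
      have hpos : 0 < S β (1 - x) := hyx ▸ S_yc_pos hβ x
      have hr := Real.sqrt_pos.2 hpos
      have hr2 : √(S β (1 - x)) ^ 2 = S β (1 - x) := Real.sq_sqrt hpos.le
      have dy : HasDerivAt (fun x : ℝ => 1 - x) (-1) x := (hasDerivAt_id x).const_sub 1
      have dS : HasDerivAt (fun x : ℝ => S β (1 - x)) (-(2 * (1 - β) * (1 - x))) x := by
        have := (((dy.pow 2).const_sub 1).const_mul (β : ℝ)).add (dy.pow 2)
        exact this.congr_deriv (by simp; ring)
      have dR := dS.sqrt hpos.ne'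
    · refine ((dy.div dR hr.ne').congr_deriv ?_).congr_of_eventuallyEq ?_
      · simp only [coefM, hyx, hr2]
        have h1 : 0 < 1 + (1 - x) := by linarith [hx'.2]
        generalize hR : √(S β (1 - x)) = R at hr hr2 ⊢
        rw [← hr2]
        field_simp
        rw [hr2, S]
        ring
      · filter_upwards [yc_eventuallyEq hx'] with t ht
        simp only [ht, Pi.div_apply]
    · have dn : HasDerivAt (fun x : ℝ => x * ((1 + (1 - x)) * β)) ((2 - 2 * x) * β) x := by
        have := (hasDerivAt_id x).mul ((dy.const_add 1).mul_const (β : ℝ))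
        exact this.congr_deriv (by simp; ring)
      refine ((dn.div dR hr.ne').congr_deriv ?_).congr_of_eventuallyEq ?_
      · simp only [coefG, hyx, hr2, zero_mul, add_zero]
        generalize hR : √(S β (1 - x)) = R at hr hr2 ⊢
        rw [← hr2]
        field_simp
        rw [hr2, S]
        ring
      · filter_upwards [yc_eventuallyEq hx'] with t ht
        simp only [ht, Pi.div_apply]
        ring
  have h1 := hsol.angle_eq_pi_div_two (fun x _ => (coefM_pos _ x).le)
    (fun x _ => coefG_nonneg hβ (l := (β, 0)) le_rfl x)
    (fun x hx => by
      refine div_pos ?_ (Real.sqrt_pos.2 (S_yc_pos hβ x))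
      rw [yc_of_mem ⟨hx.1, by linarith [hx.2]⟩]
      linarith [hx.2])
    (by rw [yc_of_mem (by norm_num)]; simp)
  rw [← h1]
  have h01 : (1 : ℝ) ∈ Icc (0 : ℝ) 1 := right_mem_Icc.2 zero_le_one
  -- Equal coefficients force equal angles, by comparison in both directions.
  exact le_antisymm
    ((isSol_rsol β (β, 0)).angle_le hsol (fun _ _ => le_rfl) (fun _ _ => le_rfl) h01)
    (hsol.angle_le (isSol_rsol β (β, 0)) (fun _ _ => le_rfl) (fun _ _ => le_rfl) h01)

/-- An explicit positive solution of a comparison equation whose flux is negative at `1`. -/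
theorem exists_negative_comparison {c : ℝ} (hc : 0 < c) (β : Ioi (0 : ℝ)) :
    ∃ g w U : ℝ → ℝ, IsSol (coefM (β, 0)) g w U ∧ 2 * c < g 0 ∧ (∀ x, 0 < w x) ∧ U 1 < 0 := by
  have hβ : (0 : ℝ) < β := β.2
  have hc1 := continuous_yc
  have hc2 : Continuous fun x => S β (yc x) := by unfold S; fun_prop
  set A := c + 1 with hA
  -- Take `w = exp (A (x² - x))`, which decreases and then increases. The system dictates `U = -w' /
  -- m` and `g = (x U)' / w`; hence `U 1 < 0` and `g 0 = 2A`, so `A = c + 1` gives `g 0 > 2c`.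
  refine ⟨fun x => A * (((2 - 2 * x) * S β (1 - x) - x * (2 - x) * (2 * (1 - β) * (1 - x))) *
      (1 - 2 * x) - 2 * (x * (2 - x) * S β (1 - x)) -
      A * (x * (2 - x) * S β (1 - x)) * (1 - 2 * x) ^ 2),
    fun x => Real.exp (A * (x ^ 2 - x)),
    fun x => (1 + yc x) * S β (yc x) * (A * (1 - 2 * x)) * Real.exp (A * (x ^ 2 - x)),
    ⟨(isSol_rsol c (β, 0)).cont_m, by unfold S; fun_prop, by fun_prop, by fun_prop,
      by simp, ?_, ?_⟩, ?_, fun x => Real.exp_pos _, ?_⟩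
  · intro x hx
    have h1 : HasDerivAt (fun x : ℝ => A * (x ^ 2 - x)) (A * (2 * x - 1)) x := by
      have := ((hasDerivAt_pow 2 x).sub (hasDerivAt_id x)).const_mul A
      exact this.congr_deriv (by simp)
    refine h1.exp.congr_deriv ?_
    have h2 := one_add_yc_pos x
    have h3 := S_yc_pos hβ x
    unfold coefM
    field_simp
    ring
  · intro x hx
    have hx' : x ∈ Ioo (0 : ℝ) (3 / 2) := ⟨hx.1, by linarith [hx.2]⟩
    have h1 : HasDerivAt (fun x : ℝ => A * (x ^ 2 - x)) (A * (2 * x - 1)) x := by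
      have := ((hasDerivAt_pow 2 x).sub (hasDerivAt_id x)).const_mul A
      exact this.congr_deriv (by simp)
    have dy : HasDerivAt (fun x : ℝ => 1 - x) (-1) x := (hasDerivAt_id x).const_sub 1
    have dS : HasDerivAt (fun x : ℝ => S β (1 - x)) (-(2 * (1 - β) * (1 - x))) x := by
      have := (((dy.pow 2).const_sub 1).const_mul (β : ℝ)).add (dy.pow 2)
      exact this.congr_deriv (by simp; ring)
    have dn : HasDerivAt (fun x : ℝ => x * (1 + (1 - x))) (2 - 2 * x) x := by
      have := (hasDerivAt_id x).mul (dy.const_add 1)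
      exact this.congr_deriv (by simp; ring)
    have d1 : HasDerivAt (fun x : ℝ => A * (1 - 2 * x)) (A * (-2)) x := by
      have := (((hasDerivAt_id x).const_mul (2 : ℝ)).const_sub 1).const_mul A
      exact this.congr_deriv (by simp)
    have := ((dn.mul dS).mul d1).mul h1.exp
    refine (this.congr_deriv ?_).congr_of_eventuallyEq ?_
    · simp only [Pi.mul_apply]
      ring
    · filter_upwards [yc_eventuallyEq hx'] with t ht
      simp only [ht, Pi.mul_apply]
      ring
  · simp [S, hA]
    linarith
  · have h1 : yc 1 = 0 := by rw [yc_of_mem (by norm_num)]; norm_num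
    have h2 : (0 : ℝ) < A := by positivity
    simp only [h1, S]
    norm_num
    positivity

/-- The weight multiplying `λ` vanishes at `x = 0`, where `coefG` equals `2c` for every `λ`. The
comparison coefficient `g` exceeds `2c` there, so it dominates on some `(0, ε)` for all `λ ≤ 0`. On
`[ε, 1]` the weight is bounded below and a very negative `λ` suffices. -/
theorem exists_Theta_neg {c : ℝ} (hc : 0 < c) (β : Ioi (0 : ℝ)) :
    ∃ lam : ℝ, Theta c (β, lam) < 0 := by
  have hβ : (0 : ℝ) < β := β.2
  obtain ⟨g, w, U, hs, hg0, hw, hU⟩ := exists_negative_comparison hc β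
  have hc1 := continuous_yc
  have hc2 : Continuous fun x => S β (yc x) := by unfold S; fun_prop
  have hSp : ∀ x, S β (yc x) ≠ 0 := fun x => (S_yc_pos hβ x).ne'
  have hcg := hs.cont_g
  set f : ℝ → ℝ := fun x => g x - c * (1 + 1 / S β (yc x)) with hf
  have hcf : Continuous f := by
    have : Continuous fun x => 1 / S β (yc x) := Continuous.div (by fun_prop) hc2 hSp
    fun_prop
  have hf0 : 0 < f 0 := by
    simp only [hf]
    rw [yc_of_mem (by norm_num)]
    norm_num [S]
    linarith
  have hev : ∀ᶠ x in 𝓝[>] (0 : ℝ), 0 < f x :=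
    (hcf.continuousAt.eventually_const_lt hf0).filter_mono nhdsWithin_le_nhds
  obtain ⟨ε, hε0, hε⟩ := mem_nhdsGT_iff_exists_Ioo_subset.1 hev
  have hε0' : (0 : ℝ) < ε := hε0
  set ρ : ℝ → ℝ := fun x => (β : ℝ) ^ 2 * (1 - yc x ^ 2) / S β (yc x) ^ 2 with hρ
  have hρc : Continuous ρ := Continuous.div (by fun_prop) (by fun_prop) fun x => pow_ne_zero 2 (hSp x)
  have hρ0 : ∀ x, 0 ≤ ρ x := fun x => by
    have h1 := one_sub_yc_sq_nonneg x
    simp only [hρ]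
    positivity
  have hρpos : ∀ x ∈ Ioc (0 : ℝ) 1, 0 < ρ x := fun x hx => by
    have h1 := S_yc_pos hβ x
    have h2 : 0 < 1 - yc x ^ 2 := by
      rw [yc_of_mem ⟨hx.1.le, by linarith [hx.2]⟩]
      nlinarith [hx.1, hx.2]
    simp only [hρ]
    positivity
  obtain ⟨N, hN⟩ := (isCompact_Icc (a := ε) (b := 1)).exists_bound_of_continuousOn
    (f := fun x => f x / ρ x) (hcf.continuousOn.div hρc.continuousOn fun x hx =>
      (hρpos x ⟨hε0'.trans_le hx.1, hx.2⟩).ne')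
  refine ⟨-|N|, ?_⟩
  refine lt_of_le_of_lt ((isSol_rsol c (β, -|N|)).angle_le hs (fun _ _ => le_rfl)
    (fun x hx => ?_) (right_mem_Icc.2 zero_le_one)) (hs.angle_neg_of_pos (fun x _ => hw x) hU)
  suffices h : -|N| * ρ x ≤ f x by
    simp only [coefG]
    simp only [hf, hρ] at h
    linarith
  rcases lt_or_ge x ε with hxε | hxε
  · have h1 : 0 < f x := hε ⟨hx.1, hxε⟩
    have := mul_nonneg (abs_nonneg N) (hρ0 x)
    linarith
  · have h1 := hρpos x ⟨hx.1, hx.2.le⟩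
    have h2 := hN x ⟨hxε, hx.2.le⟩
    rw [Real.norm_eq_abs] at h2
    have h3 : -|N| ≤ f x / ρ x := by linarith [neg_abs_le (f x / ρ x), le_abs_self N]
    rwa [le_div_iff₀ h1] at h3

end EllipsoidSL

/-! ### Transfer to the variable `z` -/

namespace EllipsoidSL

open SingularSL

theorem contDiffOn_S (β : ℝ) (s : Set ℝ) : ContDiffOn ℝ ∞ (fun x => S β (1 - x)) s := by
  unfold S
  fun_prop

/-- The regular solution is smooth in the interior. -/
theorem contDiffOn_rsol (c : ℝ) (l : Ioi (0 : ℝ) × ℝ) :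
    ContDiffOn ℝ ∞ (rsol c l) (Ioo 0 (3 / 2)) := by
  set s : Set ℝ := Ioo 0 (3 / 2) with hs
  have hso : IsOpen s := isOpen_Ioo
  have hSp : ∀ x ∈ s, S l.1 (1 - x) ≠ 0 := fun x hx =>
    (S_pos l.1.2 ⟨by linarith [hx.2], by linarith [hx.1]⟩).ne'
  have hA : ContDiffOn ℝ ∞ (fun x : ℝ => -(1 / ((1 + (1 - x)) * S l.1 (1 - x)) / x)) s := by
    have h1 := contDiffOn_S l.1 s
    refine (ContDiffOn.div (contDiffOn_const.div (ContDiffOn.mul (by fun_prop) h1) fun x hx => ?_)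
      contDiffOn_id fun x hx => hx.1.ne').neg
    exact mul_ne_zero (by linarith [hx.2]) (hSp x hx)
  have hB : ContDiffOn ℝ ∞ (fun x : ℝ => c * (1 + 1 / S l.1 (1 - x)) +
      l.2 * ((l.1 : ℝ) ^ 2 * (1 - (1 - x) ^ 2) / S l.1 (1 - x) ^ 2)) s := by
    have h1 := contDiffOn_S l.1 s
    refine ContDiffOn.add (contDiffOn_const.mul (contDiffOn_const.add
      (contDiffOn_const.div h1 hSp))) (contDiffOn_const.mul (ContDiffOn.div (by fun_prop)
      (h1.pow 2) fun x hx => pow_ne_zero 2 (hSp x hx)))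
  have hw' : ∀ x ∈ s, HasDerivAt (rsol c l)
      (-(1 / ((1 + (1 - x)) * S l.1 (1 - x)) / x) * (x * rflux c l x)) x := fun x hx => by
    have := hasDerivAt_sol continuous_coefM (continuous_coefG c) l x
    refine this.congr_deriv ?_
    rw [coefM, yc_of_mem ⟨hx.1.le, hx.2.le⟩]
    have h1 := hx.1.ne'
    rw [rflux]
    field_simp
  have hQ' : ∀ x ∈ s, HasDerivAt (fun x => x * rflux c l x)
      ((c * (1 + 1 / S l.1 (1 - x)) +
      l.2 * ((l.1 : ℝ) ^ 2 * (1 - (1 - x) ^ 2) / S l.1 (1 - x) ^ 2)) * rsol c l x) x :=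
    fun x hx => by
      have := hasDerivAt_flux continuous_coefM (continuous_coefG c) l x
      refine this.congr_deriv ?_
      rw [coefG, yc_of_mem ⟨hx.1.le, hx.2.le⟩, rsol]
  -- Bootstrap: each of `w` and the flux has derivative a smooth function times the other.
  have key : ∀ n : ℕ, ContDiffOn ℝ n (rsol c l) s ∧
      ContDiffOn ℝ n (fun x => x * rflux c l x) s := by
    intro n
    induction n with
    | zero =>
      refine ⟨contDiffOn_zero.2 fun x hx => (hw' x hx).continuousAt.continuousWithinAt,
        contDiffOn_zero.2 fun x hx => (hQ' x hx).continuousAt.continuousWithinAt⟩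
    | succ n ih =>
      constructor
      · refine (contDiffOn_succ_iff_deriv_of_isOpen hso).2
          ⟨fun x hx => (hw' x hx).differentiableAt.differentiableWithinAt,
            fun h => absurd h (WithTop.coe_ne_top (a := ((n : ℕ∞)))), ?_⟩
        exact ((hA.of_le (by exact_mod_cast le_top)).mul ih.2).congr fun x hx => (hw' x hx).deriv
      · refine (contDiffOn_succ_iff_deriv_of_isOpen hso).2
          ⟨fun x hx => (hQ' x hx).differentiableAt.differentiableWithinAt,
            fun h => absurd h (WithTop.coe_ne_top (a := ((n : ℕ∞)))), ?_⟩
        exact ((hB.of_le (by exact_mod_cast le_top)).mul ih.1).congr fun x hx => (hQ' x hx).deriv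
  exact contDiffOn_infty.2 fun n => (key n).1

/-! ### The substitution between `z` and `y`. -/

variable {a b d : ℝ}

/-- The quadratic polynomial `a² (1 - z²) + b² z²`. -/
noncomputable def W (a b z : ℝ) : ℝ := a ^ 2 * (1 - z ^ 2) + b ^ 2 * z ^ 2

theorem W_pos (ha : 0 < a) (hb : 0 < b) {z : ℝ} (hz : z ∈ Icc (-1 : ℝ) 1) : 0 < W a b z := by
  unfold W
  have h1 : 0 ≤ 1 - z ^ 2 := by nlinarith [hz.1, hz.2]
  rcases h1.eq_or_lt with h | h
  · rw [← h]
    have : 0 < z ^ 2 := by linarith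
    positivity
  · positivity

theorem Ico_subset_Icc {z : ℝ} (hz : z ∈ Ico (0 : ℝ) 1) : z ∈ Icc (-1 : ℝ) 1 :=
  ⟨by linarith [hz.1], hz.2.le⟩

/-- The change of variables `y = b z / √W`. -/
noncomputable def Y (a b z : ℝ) : ℝ := b * z / √(W a b z)

theorem p_eq (a b z : ℝ) : p a b z = (1 - z ^ 2) / √(W a b z) := rfl

theorem q_eq (ha : 0 < a) (hb : 0 < b) {z : ℝ} (hz : z ∈ Icc (-1 : ℝ) 1) :
    q a b d z = -a ^ 2 * ((W a b z + b ^ 2) / (d ^ 2 * √(W a b z) ^ 3)) := by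
  have h := W_pos ha hb hz
  have h1 : (a ^ 2 * (1 - z ^ 2) + b ^ 2 * z ^ 2) ^ (3 / 2 : ℝ) = √(W a b z) ^ 3 := by
    change (W a b z) ^ (3 / 2 : ℝ) = _
    rw [Real.sqrt_eq_rpow, ← Real.rpow_natCast, ← Real.rpow_mul h.le]
    norm_num
  unfold q
  rw [h1, show a ^ 2 * (1 - z ^ 2) + b ^ 2 * (1 + z ^ 2) = W a b z + b ^ 2 by unfold W; ring]

theorem p_pos (ha : 0 < a) (hb : 0 < b) {z : ℝ} (hz : z ∈ Ico (0 : ℝ) 1) : 0 < p a b z := by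
  rw [p_eq]
  refine div_pos ?_ (Real.sqrt_pos.2 (W_pos ha hb (Ico_subset_Icc hz)))
  nlinarith [hz.1, hz.2]

theorem contDiffOn_W (a b : ℝ) (s : Set ℝ) : ContDiffOn ℝ ∞ (W a b) s := by
  unfold W
  fun_prop

theorem contDiffOn_sqrt_W (ha : 0 < a) (hb : 0 < b) :
    ContDiffOn ℝ ∞ (fun z => √(W a b z)) (Icc (-1) 1) :=
  (contDiffOn_W a b _).sqrt fun _ hz => (W_pos ha hb hz).ne'

theorem contDiffOn_p (ha : 0 < a) (hb : 0 < b) : ContDiffOn ℝ ∞ (p a b) (Icc (-1) 1) :=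
  ContDiffOn.div (by fun_prop) (contDiffOn_sqrt_W ha hb)
    fun _ hz => (Real.sqrt_pos.2 (W_pos ha hb hz)).ne'

theorem contDiffOn_Y (ha : 0 < a) (hb : 0 < b) : ContDiffOn ℝ ∞ (Y a b) (Icc (-1) 1) :=
  ContDiffOn.div (by fun_prop) (contDiffOn_sqrt_W ha hb)
    fun _ hz => (Real.sqrt_pos.2 (W_pos ha hb hz)).ne'

theorem continuousOn_q (ha : 0 < a) (hb : 0 < b) (hd : 0 < d) :
    ContinuousOn (q a b d) (Icc (-1) 1) := by
  have h1 := (contDiffOn_sqrt_W ha hb).continuousOn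
  have h2 := (contDiffOn_W a b (Icc (-1) 1)).continuousOn
  have h3 : ContinuousOn
      (fun z => -a ^ 2 * ((W a b z + b ^ 2) / (d ^ 2 * √(W a b z) ^ 3))) (Icc (-1) 1) := by
    refine continuousOn_const.mul (ContinuousOn.div (by fun_prop) (by fun_prop) fun z hz => ?_)
    have := Real.sqrt_pos.2 (W_pos ha hb hz)
    positivity
  exact h3.congr fun z hz => q_eq ha hb hz

theorem hasDerivAt_Y (ha : 0 < a) (hb : 0 < b) {z : ℝ} (hz : z ∈ Icc (-1 : ℝ) 1) :
    HasDerivAt (Y a b) (b * a ^ 2 / √(W a b z) ^ 3) z := by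
  have h := W_pos ha hb hz
  have hr := Real.sqrt_pos.2 h
  have hr2 : √(W a b z) ^ 2 = W a b z := Real.sq_sqrt h.le
  have dW : HasDerivAt (W a b) (2 * (b ^ 2 - a ^ 2) * z) z := by
    have h1 := hasDerivAt_pow 2 z
    have := ((h1.const_sub 1).const_mul (a ^ 2)).add (h1.const_mul (b ^ 2))
    exact this.congr_deriv (by simp; ring)
  have := ((hasDerivAt_id z).const_mul b).div (dW.sqrt h.ne') hr.ne'
  refine this.congr_deriv ?_
  simp only [id, hr2]
  generalize hR : √(W a b z) = R at hr hr2 ⊢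
  rw [← hr2]
  field_simp
  rw [hr2, W]
  ring

theorem one_sub_Y_sq (ha : 0 < a) (hb : 0 < b) {z : ℝ} (hz : z ∈ Icc (-1 : ℝ) 1) :
    1 - Y a b z ^ 2 = a ^ 2 * (1 - z ^ 2) / W a b z := by
  have h := W_pos ha hb hz
  rw [Y, div_pow, Real.sq_sqrt h.le, eq_div_iff h.ne', sub_mul, div_mul_cancel₀ _ h.ne', W]
  ring

theorem S_Y (ha : 0 < a) (hb : 0 < b) {z : ℝ} (hz : z ∈ Icc (-1 : ℝ) 1) :
    S (b ^ 2 / a ^ 2) (Y a b z) = b ^ 2 / W a b z := by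
  have h := W_pos ha hb hz
  have h1 : Y a b z ^ 2 = b ^ 2 * z ^ 2 / W a b z := by
    rw [Y, div_pow, Real.sq_sqrt h.le, mul_pow]
  rw [S, one_sub_Y_sq ha hb hz, h1]
  field_simp
  ring

theorem Y_nonneg (hb : 0 < b) {z : ℝ} (hz : 0 ≤ z) : 0 ≤ Y a b z :=
  div_nonneg (mul_nonneg hb.le hz) (Real.sqrt_nonneg _)

theorem Y_zero : Y a b 0 = 0 := by simp [Y]

theorem Y_one (hb : 0 < b) : Y a b 1 = 1 := by
  simp [Y, W, Real.sqrt_sq hb.le, hb.ne']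

theorem Y_lt_one (ha : 0 < a) (hb : 0 < b) {z : ℝ} (hz : z ∈ Ico (0 : ℝ) 1) : Y a b z < 1 := by
  have h := W_pos ha hb (Ico_subset_Icc hz)
  have h1 := one_sub_Y_sq ha hb (Ico_subset_Icc hz)
  have h2 : 0 < a ^ 2 * (1 - z ^ 2) / W a b z := by
    have : 0 < 1 - z ^ 2 := by nlinarith [hz.1, hz.2]
    positivity
  nlinarith [Y_nonneg (a := a) hb hz.1]

theorem tendsto_Y (ha : 0 < a) (hb : 0 < b) : Tendsto (Y a b) (𝓝[<] 1) (𝓝 1) := by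
  have h := (hasDerivAt_Y ha hb (right_mem_Icc.2 (by norm_num : (-1 : ℝ) ≤ 1))).continuousAt.tendsto
  rw [Y_one hb] at h
  exact h.mono_left nhdsWithin_le_nhds

/-- The parameter `β = b² / a²`. -/
noncomputable def beta (ha : 0 < a) (hb : 0 < b) : Ioi (0 : ℝ) :=
  ⟨b ^ 2 / a ^ 2, div_pos (pow_pos hb 2) (pow_pos ha 2)⟩

/-! ### The regular solution and its flux as functions of `z`. -/

section Pair

variable (ha : 0 < a) (hb : 0 < b) (d)

/-- The regular solution in the variable `z`. -/
noncomputable def reg (lam z : ℝ) : ℝ := rsol (b ^ 2 / d ^ 2) (beta ha hb, lam) (1 - Y a b z)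

/-- The flux of the regular solution in the variable `z`. -/
noncomputable def regFlux (lam z : ℝ) : ℝ :=
  (1 - Y a b z) * rflux (b ^ 2 / d ^ 2) (beta ha hb, lam) (1 - Y a b z) / b

variable {d}

/-- From `dy/dz = b a² / W^{3/2}`, `S = b² / W` and `1 - y² = a² (1 - z²) / W`, the quantity `p
dv/dz` equals `x U / b`. This explains the division by `b` in `regFlux`. -/
theorem hasDerivAt_reg (lam : ℝ) {z : ℝ} (hz : z ∈ Ico (0 : ℝ) 1) :
    HasDerivAt (reg d ha hb lam) (regFlux d ha hb lam z / p a b z) z := by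
  have hz' := Ico_subset_Icc hz
  have h0 := Y_nonneg (a := a) hb hz.1
  have h1 := Y_lt_one ha hb hz
  have h := hasDerivAt_sol continuous_coefM (continuous_coefG (b ^ 2 / d ^ 2))
    (beta ha hb, lam) (1 - Y a b z)
  refine (h.comp z ((hasDerivAt_Y ha hb hz').const_sub 1)).congr_deriv ?_
  have hW := W_pos ha hb hz'
  have hr := Real.sqrt_pos.2 hW
  have hr2 : √(W a b z) ^ 2 = W a b z := Real.sq_sqrt hW.le
  have h2 := one_sub_Y_sq ha hb hz'
  have h3 : 0 < 1 - z ^ 2 := by nlinarith [hz.1, hz.2]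
  rw [regFlux, p_eq, coefM, yc_of_mem ⟨by linarith, by linarith⟩, rflux, sub_sub_cancel]
  change -(1 / ((1 + Y a b z) * S (b ^ 2 / a ^ 2) (Y a b z)) * _) * _ = _
  rw [S_Y ha hb hz']
  have h4 : 1 - Y a b z = a ^ 2 * (1 - z ^ 2) / W a b z / (1 + Y a b z) := by
    rw [← h2, eq_div_iff (by positivity)]
    ring
  generalize flux coefM (coefG (b ^ 2 / d ^ 2)) (beta ha hb, lam) (1 - Y a b z) = u
  rw [h4]
  generalize hR : √(W a b z) = R at hr hr2 ⊢
  rw [← hr2]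
  have h5 : 0 < 1 + Y a b z := by positivity
  field_simp

theorem hasDerivAt_regFlux (hd : 0 < d) (lam : ℝ) {z : ℝ} (hz : z ∈ Ico (0 : ℝ) 1) :
    HasDerivAt (regFlux d ha hb lam)
      ((q a b d z - lam * p a b z) * reg d ha hb lam z) z := by
  have hz' := Ico_subset_Icc hz
  have h0 := Y_nonneg (a := a) hb hz.1
  have h1 := Y_lt_one ha hb hz
  have h := hasDerivAt_flux continuous_coefM (continuous_coefG (b ^ 2 / d ^ 2))
    (beta ha hb, lam) (1 - Y a b z)
  refine ((h.comp z ((hasDerivAt_Y ha hb hz').const_sub 1)).div_const b).congr_deriv ?_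
  have hW := W_pos ha hb hz'
  have hr := Real.sqrt_pos.2 hW
  have hr2 : √(W a b z) ^ 2 = W a b z := Real.sq_sqrt hW.le
  rw [reg, p_eq, q_eq ha hb hz', coefG, yc_of_mem ⟨by linarith, by linarith⟩, rsol,
    sub_sub_cancel]
  change (_ * (1 + 1 / S (b ^ 2 / a ^ 2) (Y a b z)) + lam * ((b ^ 2 / a ^ 2) ^ 2 *
    (1 - Y a b z ^ 2) / S (b ^ 2 / a ^ 2) (Y a b z) ^ 2)) * _ * _ / b = _
  rw [S_Y ha hb hz', one_sub_Y_sq ha hb hz']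
  generalize sol coefM (coefG (b ^ 2 / d ^ 2)) (beta ha hb, lam) (1 - Y a b z) = u
  generalize hR : √(W a b z) = R at hr hr2 ⊢
  rw [← hr2]
  field_simp
  ring

theorem contDiffOn_reg (lam : ℝ) : ContDiffOn ℝ ∞ (reg d ha hb lam) (Ico 0 1) := by
  refine (contDiffOn_rsol (b ^ 2 / d ^ 2) (beta ha hb, lam)).comp
    (contDiffOn_const.sub ((contDiffOn_Y ha hb).mono fun z hz => Ico_subset_Icc hz))
    fun z hz => ?_
  have h0 := Y_nonneg (a := a) hb hz.1
  have h1 := Y_lt_one ha hb hz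
  exact ⟨by linarith, by linarith⟩

theorem tendsto_reg (lam : ℝ) : Tendsto (reg d ha hb lam) (𝓝[<] 1) (𝓝 1) := by
  have hs := isSol_rsol (b ^ 2 / d ^ 2) (beta ha hb, lam)
  have h1 : Tendsto (fun z => 1 - Y a b z) (𝓝[<] 1) (𝓝 0) := by
    simpa using (tendsto_Y ha hb).const_sub 1
  have h2 := (hs.cont_w.tendsto 0).comp h1
  rwa [hs.w_zero] at h2

theorem tendsto_regFlux (lam : ℝ) : Tendsto (regFlux d ha hb lam) (𝓝[<] 1) (𝓝 0) := by
  have hs := isSol_rsol (b ^ 2 / d ^ 2) (beta ha hb, lam)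
  have h1 : Tendsto (fun z => 1 - Y a b z) (𝓝[<] 1) (𝓝 0) := by
    simpa using (tendsto_Y ha hb).const_sub 1
  have h2 := ((h1.mul ((hs.cont_U.tendsto 0).comp h1)).div_const b)
  rw [zero_mul, zero_div] at h2
  exact h2

end Pair

theorem derivWithin_Ico {f : ℝ → ℝ} {f' z : ℝ} (hf : HasDerivAt f f' z) (hz : z ∈ Ico (0 : ℝ) 1) :
    der f z = f' :=
  hf.hasDerivWithinAt.derivWithin (uniqueDiffOn_Ico 0 1 z hz)

theorem p_mul_der_reg (ha : 0 < a) (hb : 0 < b) (lam : ℝ) {z : ℝ} (hz : z ∈ Ico (0 : ℝ) 1) :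
    p a b z * der (reg d ha hb lam) z = regFlux d ha hb lam z := by
  rw [derivWithin_Ico (hasDerivAt_reg ha hb lam hz) hz, mul_div_cancel₀ _ (p_pos ha hb hz).ne']

theorem L_reg (ha : 0 < a) (hb : 0 < b) (hd : 0 < d) (lam : ℝ) {z : ℝ} (hz : z ∈ Ico (0 : ℝ) 1) :
    L a b d (reg d ha hb lam) z = lam * reg d ha hb lam z := by
  have h1 : der (fun t => p a b t * der (reg d ha hb lam) t) z =
      (q a b d z - lam * p a b z) * reg d ha hb lam z := by
    rw [← derivWithin_Ico (hasDerivAt_regFlux ha hb hd lam hz) hz]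
    exact derivWithin_congr (fun t ht => p_mul_der_reg ha hb lam ht) (p_mul_der_reg ha hb lam hz)
  have hp := (p_pos ha hb hz).ne'
  rw [L, h1]
  field_simp
  ring

theorem tendsto_p_mul_der_reg (ha : 0 < a) (hb : 0 < b) (lam : ℝ) :
    Tendsto (fun z => p a b z * der (reg d ha hb lam) z) (𝓝[<] 1) (𝓝 0) := by
  refine (tendsto_regFlux (d := d) ha hb lam).congr' ?_
  filter_upwards [Ioo_mem_nhdsLT (zero_lt_one' ℝ)] with z hz
  exact (p_mul_der_reg ha hb lam ⟨hz.1.le, hz.2⟩).symm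

theorem exists_reg_ne_zero (ha : 0 < a) (hb : 0 < b) (lam : ℝ) :
    ∃ z ∈ Ico (0 : ℝ) 1, reg d ha hb lam z ≠ 0 := by
  have h1 := (tendsto_reg (d := d) ha hb lam).eventually_const_lt zero_lt_one
  obtain ⟨z, h2, h3⟩ := (h1.and (Ioo_mem_nhdsLT (zero_lt_one' ℝ))).exists
  exact ⟨z, ⟨h3.1.le, h3.2⟩, h2.ne'⟩

end EllipsoidSL

/-! ### Eigenvalues in terms of the rotation angle -/

namespace EllipsoidSL

open SingularSL

variable {a b d : ℝ}

theorem Ico_mem_nhdsGE {z : ℝ} (hz : z ∈ Ico (0 : ℝ) 1) : Ico (0 : ℝ) 1 ∈ 𝓝[≥] z :=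
  mem_of_superset (Ico_mem_nhdsGE_of_mem (left_mem_Ico.2 hz.2)) (Ico_subset_Ico_left hz.1)

/-- A classical solution of `L v = λ v` satisfying the boundary condition at the singular
endpoint. -/
structure IsEigen (a b d lam : ℝ) (v : ℝ → ℝ) : Prop where
  smooth : ContDiffOn ℝ ∞ v (Ico 0 1)
  tendsto : Tendsto (fun z => p a b z * der v z) (𝓝[<] 1) (𝓝 0)
  eqn : ∀ z ∈ Ico (0 : ℝ) 1, L a b d v z = lam * v z

namespace IsEigen

variable {lam : ℝ} {v : ℝ → ℝ}

theorem hasDerivWithinAt (h : IsEigen a b d lam v) (ha : 0 < a) (hb : 0 < b) {z : ℝ}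
    (hz : z ∈ Ico (0 : ℝ) 1) :
    HasDerivWithinAt v (p a b z * der v z / p a b z) (Ico 0 1) z := by
  rw [mul_div_cancel_left₀ _ (p_pos ha hb hz).ne']
  exact ((h.smooth.differentiableOn (by simp)) z hz).hasDerivWithinAt

theorem hasDerivWithinAt_flux (h : IsEigen a b d lam v) (ha : 0 < a) (hb : 0 < b) {z : ℝ}
    (hz : z ∈ Ico (0 : ℝ) 1) :
    HasDerivWithinAt (fun z => p a b z * der v z) ((q a b d z - lam * p a b z) * v z)
      (Ico 0 1) z := by
  have h1 : ContDiffOn ℝ ∞ (fun z => p a b z * der v z) (Ico 0 1) :=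
    ((contDiffOn_p ha hb).mono fun z hz => Ico_subset_Icc hz).mul
      (h.smooth.derivWithin (uniqueDiffOn_Ico 0 1) (by simp))
  have h2 := ((h1.differentiableOn (by simp)) z hz).hasDerivWithinAt
  refine h2.congr_deriv ?_
  have h3 := h.eqn z hz
  have hp := (p_pos ha hb hz).ne'
  rw [L, one_div, inv_mul_eq_iff_eq_mul₀ hp] at h3
  rw [der] at h3
  linarith

/-- A solution with vanishing Cauchy data at `0` vanishes. -/
theorem eq_zero (h : IsEigen a b d lam v) (ha : 0 < a) (hb : 0 < b) (hd : 0 < d)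
    (hv : v 0 = 0) (hv' : p a b 0 * der v 0 = 0) {t : ℝ} (ht : t ∈ Ico (0 : ℝ) 1) : v t = 0 := by
  have hsub : Icc 0 t ⊆ Ico (0 : ℝ) 1 := fun z hz => ⟨hz.1, hz.2.trans_lt ht.2⟩
  have hpc : ContinuousOn (p a b) (Icc 0 t) :=
    (contDiffOn_p ha hb).continuousOn.mono fun z hz => Ico_subset_Icc (hsub hz)
  have hqc : ContinuousOn (q a b d) (Icc 0 t) :=
    (continuousOn_q ha hb hd).mono fun z hz => Ico_subset_Icc (hsub hz)
  obtain ⟨K, hK⟩ := isCompact_Icc.exists_bound_of_continuousOn (f := fun z => (p a b z)⁻¹)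
    (hpc.inv₀ fun z hz => (p_pos ha hb (hsub hz)).ne')
  obtain ⟨M, hM⟩ := isCompact_Icc.exists_bound_of_continuousOn
    (f := fun z => q a b d z - lam * p a b z) (hqc.sub (continuousOn_const.mul hpc))
  have hmem : ∀ z ∈ Ico 0 t, z ∈ Ico (0 : ℝ) 1 := fun z hz => hsub ⟨hz.1, hz.2.le⟩
  refine (eq_zero_of_system (u := v) (v := fun z => p a b z * der v z)
    (u' := fun z => p a b z * der v z / p a b z)
    (v' := fun z => (q a b d z - lam * p a b z) * v z) (K := max K M)
    (fun z hz => ((h.hasDerivWithinAt ha hb (hsub hz)).continuousWithinAt).mono hsub)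
    (fun z hz => ((h.hasDerivWithinAt_flux ha hb (hsub hz)).continuousWithinAt).mono hsub)
    (fun z hz => (h.hasDerivWithinAt ha hb (hmem z hz)).mono_of_mem_nhdsWithin
      (Ico_mem_nhdsGE (hmem z hz)))
    (fun z hz => (h.hasDerivWithinAt_flux ha hb (hmem z hz)).mono_of_mem_nhdsWithin
      (Ico_mem_nhdsGE (hmem z hz))) hv hv'
    (fun z hz => ?_) (fun z hz => ?_) t (right_mem_Icc.2 ht.1)).1
  · have := hK z ⟨hz.1, hz.2.le⟩
    rw [Real.norm_eq_abs] at this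
    rw [div_eq_inv_mul, abs_mul]
    exact mul_le_mul_of_nonneg_right (this.trans (le_max_left _ _)) (abs_nonneg _)
  · have := hM z ⟨hz.1, hz.2.le⟩
    rw [Real.norm_eq_abs] at this
    rw [abs_mul]
    exact mul_le_mul_of_nonneg_right (this.trans (le_max_right _ _)) (abs_nonneg _)

/-- A solution grows at most logarithmically at the singular endpoint. -/
theorem tendsto_mul (h : IsEigen a b d lam v) (ha : 0 < a) (hb : 0 < b) :
    Tendsto (fun z => (1 - z) * v z) (𝓝[<] 1) (𝓝 0) := by
  obtain ⟨R, hR⟩ := (isCompact_Icc (a := (-1 : ℝ)) (b := 1)).exists_bound_of_continuousOn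
    (contDiffOn_sqrt_W ha hb).continuousOn
  -- Near `1` the flux is below `1` in absolute value and `p ≥ (1 - z) / R`, so `|v'| ≤ R / (1 -
  -- z)`; integrating this from `z₁` gives the logarithmic bound.
  obtain ⟨c, hc, hcP⟩ := mem_nhdsLT_iff_exists_Ioo_subset.1
    (h.tendsto.abs.eventually_lt_const (by simp : |(0 : ℝ)| < 1))
  set z₁ : ℝ := (max c 0 + 1) / 2 with hz₁
  have hc1 : max c 0 < 1 := max_lt hc one_pos
  have hz1 : z₁ < 1 := by linarith
  have hz1c : c < z₁ := by linarith [le_max_left c 0]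
  have hz10 : 0 < z₁ := by linarith [le_max_right c 0]
  have hmem : ∀ z ∈ Ico z₁ 1, z ∈ Ico (0 : ℝ) 1 := fun z hz => ⟨hz10.le.trans hz.1, hz.2⟩
  have hint : ∀ z ∈ Ioo z₁ 1, HasDerivAt v (p a b z * der v z / p a b z) z := fun z hz =>
    (h.hasDerivWithinAt ha hb (hmem z ⟨hz.1.le, hz.2⟩)).hasDerivAt
      (Ico_mem_nhds (hz10.trans hz.1) hz.2)
  have hlog : ∀ z ∈ Ioo z₁ 1, HasDerivAt (fun z => R * Real.log (1 - z)) (-(R / (1 - z))) z := by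
    intro z hz
    have := (((hasDerivAt_id z).const_sub 1).log (by simp only [id]; linarith [hz.2])).const_mul R
    exact this.congr_deriv (by simp only [id]; ring)
  have hbd : ∀ z ∈ Ioo z₁ 1, |p a b z * der v z / p a b z| ≤ R / (1 - z) := by
    intro z hz
    have hz' := hmem z ⟨hz.1.le, hz.2⟩
    have h1 : |p a b z * der v z| < 1 := hcP ⟨hz1c.trans hz.1, hz.2⟩
    have h2 := hR z (Ico_subset_Icc hz')
    rw [Real.norm_eq_abs] at h2
    have h3 := (le_abs_self _).trans h2
    have h4 := Real.sqrt_pos.2 (W_pos ha hb (Ico_subset_Icc hz'))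
    have h5 : 0 < 1 - z := by linarith [hz.2]
    rw [abs_div, abs_of_pos (p_pos ha hb hz'), div_le_iff₀ (p_pos ha hb hz'), p_eq]
    refine h1.le.trans ?_
    rw [div_mul_div_comm, le_div_iff₀ (by positivity), one_mul]
    have h6 : (1 - z) ≤ (1 - z ^ 2) := by nlinarith [hz'.1]
    nlinarith [mul_le_mul_of_nonneg_left h6 (h4.le.trans h3),
      mul_le_mul_of_nonneg_left h3 h5.le]
  have hvc : ContinuousOn v (Ico z₁ 1) := h.smooth.continuousOn.mono fun z hz => hmem z hz
  have hlc : ContinuousOn (fun z => R * Real.log (1 - z)) (Ico z₁ 1) :=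
    continuousOn_const.mul (ContinuousOn.log (by fun_prop) fun z hz => by linarith [hz.2])
  have hmono : MonotoneOn (fun z => v z - R * Real.log (1 - z)) (Ico z₁ 1) := by
    refine monotoneOn_of_hasDerivWithinAt_nonneg (convex_Ico z₁ 1)
      (f' := fun z => p a b z * der v z / p a b z - -(R / (1 - z))) (hvc.sub hlc)
      (fun z hz => ?_) (fun z hz => ?_)
    · rw [interior_Ico] at hz
      exact ((hint z hz).sub (hlog z hz)).hasDerivWithinAt
    · rw [interior_Ico] at hz
      linarith [(abs_le.1 (hbd z hz)).1]
  have hmono' : MonotoneOn (fun z => -v z - R * Real.log (1 - z)) (Ico z₁ 1) := by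
    refine monotoneOn_of_hasDerivWithinAt_nonneg (convex_Ico z₁ 1)
      (f' := fun z => -(p a b z * der v z / p a b z) - -(R / (1 - z))) (hvc.neg.sub hlc)
      (fun z hz => ?_) (fun z hz => ?_)
    · rw [interior_Ico] at hz
      exact ((hint z hz).neg.sub (hlog z hz)).hasDerivWithinAt
    · rw [interior_Ico] at hz
      linarith [(abs_le.1 (hbd z hz)).2]
  set B := |v z₁| + |R * Real.log (1 - z₁)| with hB
  have hsub : Tendsto (fun z : ℝ => 1 - z) (𝓝[<] 1) (𝓝[>] 0) := by
    refine tendsto_nhdsWithin_iff.2 ⟨?_, ?_⟩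
    · have : Tendsto (fun z : ℝ => 1 - z) (𝓝 1) (𝓝 (1 - 1)) := by
        exact (continuous_const.sub continuous_id).tendsto 1
      rw [sub_self] at this
      exact this.mono_left nhdsWithin_le_nhds
    · filter_upwards [self_mem_nhdsWithin] with z hz
      exact mem_Ioi.2 (sub_pos.2 (mem_Iio.1 hz))
  have hlim : Tendsto (fun z => (1 - z) * B + |R| * |Real.log (1 - z) * (1 - z)|)
      (𝓝[<] 1) (𝓝 0) := by
    have e1 := (hsub.mono_right nhdsWithin_le_nhds).mul_const B
    have e2 := (tendsto_log_mul_rpow_nhdsGT_zero one_pos).comp hsub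
    simp only [Function.comp_def, Real.rpow_one] at e2
    simpa using e1.add (e2.abs.const_mul |R|)
  refine squeeze_zero_norm' ?_ hlim
  filter_upwards [Ioo_mem_nhdsLT hz1] with z hz
  have hzI : z ∈ Ico z₁ 1 := ⟨hz.1.le, hz.2⟩
  have e1 := hmono (left_mem_Ico.2 hz1) hzI hz.1.le
  have e2 := hmono' (left_mem_Ico.2 hz1) hzI hz.1.le
  simp only at e1 e2
  have h5 : 0 < 1 - z := by linarith [hz.2]
  have e3 : |v z| ≤ B + |R| * |Real.log (1 - z)| := by
    rw [← abs_mul, hB]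
    have i1 := neg_abs_le (v z₁)
    have i2 := le_abs_self (v z₁)
    have i3 := le_abs_self (R * Real.log (1 - z₁))
    have i4 := neg_abs_le (R * Real.log (1 - z))
    rw [abs_le]
    constructor <;> linarith
  rw [Real.norm_eq_abs, abs_mul, abs_of_pos h5, abs_mul, abs_of_pos h5]
  nlinarith [mul_le_mul_of_nonneg_left e3 h5.le]

/-- The Wronskian of a solution with the regular solution vanishes. -/
theorem wronskian_eq_zero (h : IsEigen a b d lam v) (ha : 0 < a) (hb : 0 < b) (hd : 0 < d) :
    v 0 * regFlux d ha hb lam 0 = reg d ha hb lam 0 * (p a b 0 * der v 0) := by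
  set D : ℝ → ℝ := fun z =>
    v z * regFlux d ha hb lam z - reg d ha hb lam z * (p a b z * der v z) with hD
  have hderiv : ∀ z ∈ Ico (0 : ℝ) 1, HasDerivWithinAt D 0 (Ico 0 1) z := by
    intro z hz
    have hp := (p_pos ha hb hz).ne'
    have := ((h.hasDerivWithinAt ha hb hz).mul
      (hasDerivAt_regFlux ha hb hd lam hz).hasDerivWithinAt).sub
      ((hasDerivAt_reg (d := d) ha hb lam hz).hasDerivWithinAt.mul
        (h.hasDerivWithinAt_flux ha hb hz))
    refine this.congr_deriv ?_
    field_simp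
    ring
  have hconst : ∀ t ∈ Ico (0 : ℝ) 1, D t = D 0 := by
    intro t ht
    have hsub : Icc 0 t ⊆ Ico (0 : ℝ) 1 := fun z hz => ⟨hz.1, hz.2.trans_lt ht.2⟩
    refine constant_of_has_deriv_right_zero
      (fun z hz => (hderiv z (hsub hz)).continuousWithinAt.mono hsub)
      (fun z hz => ?_) t (right_mem_Icc.2 ht.1)
    have hz' := hsub ⟨hz.1, hz.2.le⟩
    exact (hderiv z hz').mono_of_mem_nhdsWithin (Ico_mem_nhdsGE hz')
  -- One product tends to `1 · 0`. In the other, `v` may be unbounded, but `regFlux` carries the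
  -- factor `1 - Y`, a bounded multiple of `1 - z`, and `(1 - z) v → 0`.
  have hlim : Tendsto D (𝓝[<] 1) (𝓝 0) := by
    have e1 := (tendsto_reg (d := d) ha hb lam).mul h.tendsto
    have hs := isSol_rsol (b ^ 2 / d ^ 2) (beta ha hb, lam)
    have e2 : Tendsto (fun z => 1 - Y a b z) (𝓝[<] 1) (𝓝 0) := by
      simpa using (tendsto_Y ha hb).const_sub 1
    have e3 := (hs.cont_U.tendsto 0).comp e2
    have hid : Tendsto (fun z : ℝ => z) (𝓝[<] 1) (𝓝 1) := nhdsWithin_le_nhds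
    have hW : Tendsto (W a b) (𝓝[<] 1) (𝓝 (W a b 1)) := by
      have : Continuous (W a b) := by unfold W; fun_prop
      exact (this.tendsto 1).mono_left nhdsWithin_le_nhds
    have hW1 : W a b 1 ≠ 0 := (W_pos ha hb (right_mem_Icc.2 (by norm_num))).ne'
    have e4 : Tendsto (fun z => a ^ 2 * (1 + z) / W a b z / (1 + Y a b z)) (𝓝[<] 1)
        (𝓝 (a ^ 2 * (1 + 1) / W a b 1 / (1 + 1))) :=
      ((((hid.const_add 1).const_mul (a ^ 2)).div hW hW1).div
        ((tendsto_Y ha hb).const_add 1) (by norm_num))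
    have e5 := ((h.tendsto_mul ha hb).mul ((e4.mul e3).div_const b)).sub e1
    simp only [zero_mul, mul_zero, sub_zero] at e5
    refine e5.congr' ?_
    filter_upwards [Ioo_mem_nhdsLT (zero_lt_one' ℝ)] with z hz
    have hz' : z ∈ Ico (0 : ℝ) 1 := ⟨hz.1.le, hz.2⟩
    have f1 := one_sub_Y_sq ha hb (Ico_subset_Icc hz')
    have f2 : 1 + Y a b z ≠ 0 := by
      have := Y_nonneg (a := a) hb hz.1.le
      positivity
    have f3 : 1 - Y a b z = (1 - z) * (a ^ 2 * (1 + z) / W a b z / (1 + Y a b z)) := by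
      have : (1 - z) * (a ^ 2 * (1 + z) / W a b z / (1 + Y a b z)) =
          (1 - Y a b z ^ 2) / (1 + Y a b z) := by rw [f1]; ring
      rw [this, eq_div_iff f2]
      ring
    simp only [hD, regFlux, Function.comp_apply]
    generalize rflux (b ^ 2 / d ^ 2) (beta ha hb, lam) (1 - Y a b z) = u
    linear_combination -(v z * u / b) * f3
  have hD0 : D 0 = 0 := by
    refine tendsto_nhds_unique ?_ hlim
    refine (tendsto_const_nhds (x := D 0)).congr' ?_
    filter_upwards [Ioo_mem_nhdsLT (zero_lt_one' ℝ)] with z hz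
    exact (hconst z ⟨hz.1.le, hz.2⟩).symm
  exact sub_eq_zero.1 hD0

end IsEigen

/-- The rotation angle of the problem with parameters `a`, `b`, `d` and spectral value `λ`. -/
noncomputable def phase (d : ℝ) (ha : 0 < a) (hb : 0 < b) (lam : ℝ) : ℝ :=
  Theta (b ^ 2 / d ^ 2) (beta ha hb, lam)

theorem reg_zero_eq_zero_iff (ha : 0 < a) (hb : 0 < b) (lam : ℝ) :
    reg d ha hb lam 0 = 0 ↔ Real.cos (phase d ha hb lam) = 0 := by
  rw [phase, Theta, (isSol_rsol _ _).cos_angle_eq_zero_iff (right_mem_Icc.2 zero_le_one), reg,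
    Y_zero, sub_zero]

theorem regFlux_zero_eq_zero_iff (ha : 0 < a) (hb : 0 < b) (lam : ℝ) :
    regFlux d ha hb lam 0 = 0 ↔ Real.sin (phase d ha hb lam) = 0 := by
  rw [phase, Theta, (isSol_rsol _ _).sin_angle_eq_zero_iff (right_mem_Icc.2 zero_le_one), regFlux,
    Y_zero, sub_zero, div_eq_zero_iff, or_iff_left hb.ne']

/-- For an even eigenfunction the Wronskian identity reads `v 0 * regFlux 0 = 0`, and `v 0 ≠ 0` by
uniqueness at the regular endpoint. Conversely `reg` itself is an eigenfunction. -/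
theorem mem_specEven_iff (ha : 0 < a) (hb : 0 < b) (hd : 0 < d) (lam : ℝ) :
    lam ∈ specEven a b d ↔ Real.sin (phase d ha hb lam) = 0 := by
  have h00 : (0 : ℝ) ∈ Ico (0 : ℝ) 1 := left_mem_Ico.2 one_pos
  rw [← regFlux_zero_eq_zero_iff]
  constructor
  · rintro ⟨v, ⟨h1, h2, h3⟩, ⟨z, hz, hvz⟩, h4⟩
    have h : IsEigen a b d lam v := ⟨h1, h3, h4⟩
    have hP : p a b 0 * der v 0 = 0 := by rw [h2, mul_zero]
    have hw := h.wronskian_eq_zero ha hb hd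
    rw [hP, mul_zero, mul_eq_zero] at hw
    exact hw.resolve_left fun hv => hvz (h.eq_zero ha hb hd hv hP hz)
  · intro hF
    refine ⟨reg d ha hb lam, ⟨contDiffOn_reg ha hb lam, ?_, tendsto_p_mul_der_reg ha hb lam⟩,
      exists_reg_ne_zero ha hb lam, fun z hz => L_reg ha hb hd lam hz⟩
    rw [derivWithin_Ico (hasDerivAt_reg ha hb lam h00) h00, hF, zero_div]

theorem mem_specOdd_iff (ha : 0 < a) (hb : 0 < b) (hd : 0 < d) (lam : ℝ) :
    lam ∈ specOdd a b d ↔ Real.cos (phase d ha hb lam) = 0 := by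
  rw [← reg_zero_eq_zero_iff]
  constructor
  · rintro ⟨v, ⟨h1, h2, h3⟩, ⟨z, hz, hvz⟩, h4⟩
    have h : IsEigen a b d lam v := ⟨h1, h3, h4⟩
    have hw := h.wronskian_eq_zero ha hb hd
    rw [h2, zero_mul, eq_comm, mul_eq_zero] at hw
    exact hw.resolve_right fun hP => hvz (h.eq_zero ha hb hd h2 hP hz)
  · intro hF
    exact ⟨reg d ha hb lam, ⟨contDiffOn_reg ha hb lam, hF, tendsto_p_mul_der_reg ha hb lam⟩,
      exists_reg_ne_zero ha hb lam, fun z hz => L_reg ha hb hd lam hz⟩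

end EllipsoidSL

/-! ### Enumeration of the spectra and of the degeneracy instants -/

namespace EllipsoidSL

variable {a b d : ℝ}

theorem phase_strictMono (d : ℝ) (ha : 0 < a) (hb : 0 < b) : StrictMono (phase d ha hb) :=
  Theta_strictMono _ _

theorem phase_zero_lt {a' : ℝ} (ha : 0 < a) (ha' : 0 < a') (hb : 0 < b) (hd : 0 < d)
    (h : a < a') : phase d ha hb 0 < phase d ha' hb 0 := by
  refine Theta_strictAnti (c := b ^ 2 / d ^ 2) (by positivity) ?_
  change b ^ 2 / a' ^ 2 < b ^ 2 / a ^ 2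
  gcongr

theorem exists_phase_eq (ha : 0 < a) (hb : 0 < b) (hd : 0 < d) {t : ℝ} (ht : 0 ≤ t) :
    ∃ lam, phase d ha hb lam = t := by
  have hc : 0 < b ^ 2 / d ^ 2 := by positivity
  obtain ⟨l₁, h₁⟩ := exists_Theta_neg hc (beta ha hb)
  obtain ⟨l₂, h₂⟩ := exists_lt_Theta_lam hc (beta ha hb) t
  have hcont : Continuous (phase d ha hb) :=
    (continuous_Theta (b ^ 2 / d ^ 2)).comp (Continuous.prodMk_right (beta ha hb))
  exact mem_range_of_exists_le_of_exists_ge hcont ⟨l₁, h₁.le.trans ht⟩ ⟨l₂, h₂.le⟩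

theorem phase_self (hb : 0 < b) (hd : 0 < d) : phase d hd hb 0 = Real.pi / 2 :=
  Theta_self (beta hd hb)

/-- Intermediate value theorem in `β` on the connected half-line, between `β = c`, where the angle
is `π/2`, and a small `β`, where it exceeds `t`. Then `a = b / √β`. -/
theorem exists_phase_zero_eq (hb : 0 < b) (hd : 0 < d) {t : ℝ} (ht : Real.pi / 2 ≤ t) :
    ∃ a, ∃ ha : 0 < a, phase d ha hb 0 = t := by
  have hc : 0 < b ^ 2 / d ^ 2 := by positivity
  obtain ⟨β₂, h₂⟩ := exists_lt_Theta_beta hc t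
  have hcont : Continuous fun β : Ioi (0 : ℝ) => Theta (b ^ 2 / d ^ 2) (β, 0) :=
    (continuous_Theta (b ^ 2 / d ^ 2)).comp (Continuous.prodMk_left 0)
  have : PreconnectedSpace (Ioi (0 : ℝ)) := Subtype.preconnectedSpace isPreconnected_Ioi
  obtain ⟨β, hβ⟩ := mem_range_of_exists_le_of_exists_ge hcont
    ⟨beta hd hb, (phase_self hb hd).le.trans ht⟩ ⟨β₂, h₂.le⟩
  have hβ0 : (0 : ℝ) < β := β.2
  have hs := Real.sqrt_pos.2 hβ0
  refine ⟨b / √β, div_pos hb hs, ?_⟩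
  rw [← hβ, phase]
  congr 2
  ext
  change b ^ 2 / (b / √β) ^ 2 = (β : ℝ)
  rw [div_pow, Real.sq_sqrt hβ0.le]
  field_simp

theorem sin_eq_zero_iff_exists_nat {θ : ℝ} (hθ : -(Real.pi / 2) < θ) :
    Real.sin θ = 0 ↔ ∃ n : ℕ, θ = n * Real.pi := by
  constructor
  · intro h
    obtain ⟨n, hn⟩ := Real.sin_eq_zero_iff.1 h
    have h1 : (-1 : ℝ) < n := by
      have := Real.pi_pos
      by_contra hcon
      nlinarith
    have h2 : (-1 : ℤ) < n := by exact_mod_cast h1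
    lift n to ℕ using by omega
    exact ⟨n, by rw [← hn]; simp⟩
  · rintro ⟨n, rfl⟩
    exact Real.sin_nat_mul_pi n

/-- The strict lower bound removes the zero at `-π/2`, so the index starts at `0`. -/
theorem cos_eq_zero_iff_exists_nat {θ : ℝ} (hθ : -(Real.pi / 2) < θ) :
    Real.cos θ = 0 ↔ ∃ n : ℕ, θ = n * Real.pi + Real.pi / 2 := by
  constructor
  · intro h
    obtain ⟨n, hn⟩ := Real.cos_eq_zero_iff.1 h
    have h1 : (-1 : ℝ) < n := by
      have := Real.pi_pos
      by_contra hcon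
      nlinarith
    have h2 : (-1 : ℤ) < n := by exact_mod_cast h1
    lift n to ℕ using by omega
    exact ⟨n, by rw [hn]; push_cast; ring⟩
  · rintro ⟨n, rfl⟩
    exact Real.cos_eq_zero_iff.2 ⟨n, by push_cast; ring⟩

/-- Preimages of an increasing sequence of values under an increasing function form an
enumeration. -/
theorem enumerates_of_strictMonoOn {I T : Set ℝ} {F : ℝ → ℝ} {t s : ℕ → ℝ} {k : ℕ}
    (hI : IsUpperSet I) (hF : StrictMonoOn F I) (ht : StrictMono t) (ht' : Tendsto t atTop atTop)
    (hs : ∀ n, k ≤ n → s n ∈ I ∧ F (s n) = t n)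
    (hT : ∀ x, x ∈ T ↔ x ∈ I ∧ ∃ n, k ≤ n ∧ F x = t n) : Enumerates s k T := by
  refine ⟨fun m hm n hn hmn => ?_, ?_, ?_⟩
  · rw [← hF.lt_iff_lt (hs m hm).1 (hs n hn).1, (hs m hm).2, (hs n hn).2]
    exact ht hmn
  · refine tendsto_atTop.2 fun M => ?_
    have hmem : max M (s k) ∈ I := hI (le_max_right _ _) (hs k le_rfl).1
    filter_upwards [ht'.eventually_ge_atTop (F (max M (s k))), eventually_ge_atTop k] with n h1 h2
    rw [← (hs n h2).2, hF.le_iff_le hmem (hs n h2).1] at h1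
    exact (le_max_left _ _).trans h1
  · ext x
    rw [hT]
    constructor
    · rintro ⟨n, hn, rfl⟩
      exact ⟨(hs n hn).1, n, hn, (hs n hn).2⟩
    · rintro ⟨hx, n, hn, hxn⟩
      exact ⟨n, hn, hF.injOn (hs n hn).1 hx ((hs n hn).2.trans hxn.symm)⟩

theorem strictMono_mul_pi : StrictMono fun n : ℕ => (n : ℝ) * Real.pi := fun m n h => by
  have := Real.pi_pos
  simp only
  gcongr

theorem tendsto_mul_pi : Tendsto (fun n : ℕ => (n : ℝ) * Real.pi) atTop atTop :=
  tendsto_natCast_atTop_atTop.atTop_mul_const Real.pi_pos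

end EllipsoidSL

/-! ### Assembly of the main theorem. -/

theorem mainTheorem6 (b d : ℝ) (hb : 0 < b) (hd : 0 < d) :
    ∃ (lamEven lamOdd : ℕ → ℝ → ℝ) (aEven aOdd : ℕ → ℝ),
      -- the spectra, listed in increasing order
      (∀ a : ℝ, 0 < a →
        EllipsoidSL.Enumerates (fun n => lamEven n a) 0 (EllipsoidSL.specEven a b d) ∧
        EllipsoidSL.Enumerates (fun n => lamOdd n a) 0 (EllipsoidSL.specOdd a b d)) ∧
      -- the degeneracy instants, listed in increasing order from `n = 1`, respectively `n = 0`
      EllipsoidSL.Enumerates aEven 1 (EllipsoidSL.degEven b d) ∧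
      EllipsoidSL.Enumerates aOdd 0 (EllipsoidSL.degOdd b d) ∧
      -- the spectra are intertwined
      (∀ a : ℝ, 0 < a → ∀ n : ℕ, lamEven n a < lamOdd n a ∧ lamOdd n a < lamEven (n + 1) a) ∧
      -- each eigenvalue is negative for large `a`
      (∀ n : ℕ, ∃ A : ℝ, 0 < A ∧ ∀ a : ℝ, A < a → lamEven n a < 0 ∧ lamOdd n a < 0) ∧
      -- signs and zeros of the eigenvalues
      (∀ a : ℝ, 0 < a → lamEven 0 a < 0) ∧
      (∀ n : ℕ, 1 ≤ n →
        (∀ a : ℝ, 0 < a → a < aEven n → 0 < lamEven n a) ∧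
        lamEven n (aEven n) = 0 ∧
        (∀ a : ℝ, aEven n < a → lamEven n a < 0)) ∧
      (∀ n : ℕ,
        (∀ a : ℝ, 0 < a → a < aOdd n → 0 < lamOdd n a) ∧
        lamOdd n (aOdd n) = 0 ∧
        (∀ a : ℝ, aOdd n < a → lamOdd n a < 0)) ∧
      -- the degeneracy instants are intertwined
      aOdd 0 = d ∧
      (∀ n : ℕ, aOdd n < aEven (n + 1) ∧ aEven (n + 1) < aOdd (n + 1)) := by
  have hπ := Real.pi_pos
  have hE : ∀ (n : ℕ) (a : ℝ), ∃ lam, ∀ ha : 0 < a,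
      EllipsoidSL.phase d ha hb lam = n * Real.pi := by
    intro n a
    by_cases ha : 0 < a
    · obtain ⟨l, hl⟩ := EllipsoidSL.exists_phase_eq ha hb hd (t := n * Real.pi) (by positivity)
      exact ⟨l, fun _ => hl⟩
    · exact ⟨0, fun h => absurd h ha⟩
  have hO : ∀ (n : ℕ) (a : ℝ), ∃ lam, ∀ ha : 0 < a,
      EllipsoidSL.phase d ha hb lam = n * Real.pi + Real.pi / 2 := by
    intro n a
    by_cases ha : 0 < a
    · obtain ⟨l, hl⟩ := EllipsoidSL.exists_phase_eq ha hb hd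
        (t := n * Real.pi + Real.pi / 2) (by positivity)
      exact ⟨l, fun _ => hl⟩
    · exact ⟨0, fun h => absurd h ha⟩
  -- The index `0` is excluded because the phase at `λ = 0` is positive; `aEven 0` is arbitrary.
  have hAE : ∀ n : ℕ, ∃ a, 1 ≤ n → ∃ ha : 0 < a, EllipsoidSL.phase d ha hb 0 = n * Real.pi := by
    intro n
    by_cases hn : 1 ≤ n
    · have h1 : (1 : ℝ) ≤ n := by exact_mod_cast hn
      obtain ⟨a, ha⟩ := EllipsoidSL.exists_phase_zero_eq hb hd (t := n * Real.pi) (by nlinarith)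
      exact ⟨a, fun _ => ha⟩
    · exact ⟨0, fun h => absurd h hn⟩
  have hAO : ∀ n : ℕ, ∃ a, ∃ ha : 0 < a,
      EllipsoidSL.phase d ha hb 0 = n * Real.pi + Real.pi / 2 := fun n =>
    EllipsoidSL.exists_phase_zero_eq hb hd (le_add_of_nonneg_left (by positivity))
  choose lamEven hlamE using hE
  choose lamOdd hlamO using hO
  choose aEven haE using hAE
  choose aOdd haO hphO using hAO
  have hlow : ∀ {a : ℝ} (ha : 0 < a) (lam : ℝ),
      -(Real.pi / 2) < EllipsoidSL.phase d ha hb lam := fun ha lam =>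
    EllipsoidSL.neg_pi_div_two_lt_Theta _ _ lam
  have hmono : ∀ {a : ℝ} (ha : 0 < a), StrictMono (EllipsoidSL.phase d ha hb) := fun ha =>
    EllipsoidSL.phase_strictMono d ha hb
  have hpos : ∀ {a : ℝ} (ha : 0 < a), 0 < EllipsoidSL.phase d ha hb 0 := fun ha =>
    EllipsoidSL.Theta_pos (by positivity) _
  set F : ℝ → ℝ := fun a => if ha : 0 < a then EllipsoidSL.phase d ha hb 0 else 0 with hFdef
  have hF : ∀ {a : ℝ} (ha : 0 < a), F a = EllipsoidSL.phase d ha hb 0 := fun ha => dif_pos ha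
  have hFmono : StrictMonoOn F (Ioi 0) := fun x hx y hy hxy => by
    rw [hF hx, hF hy]
    exact EllipsoidSL.phase_zero_lt hx hy hb hd hxy
  have hFE : ∀ n : ℕ, 1 ≤ n → aEven n ∈ Ioi (0 : ℝ) ∧ F (aEven n) = n * Real.pi := fun n hn => by
    obtain ⟨h1, h2⟩ := haE n hn
    exact ⟨h1, (hF h1).trans h2⟩
  have hFO : ∀ n : ℕ, aOdd n ∈ Ioi (0 : ℝ) ∧ F (aOdd n) = n * Real.pi + Real.pi / 2 := fun n =>
    ⟨haO n, (hF (haO n)).trans (hphO n)⟩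
  have htO : StrictMono fun n : ℕ => (n : ℝ) * Real.pi + Real.pi / 2 :=
    EllipsoidSL.strictMono_mul_pi.add_const _
  have htO' : Tendsto (fun n : ℕ => (n : ℝ) * Real.pi + Real.pi / 2) atTop atTop :=
    tendsto_atTop_add_const_right _ _ EllipsoidSL.tendsto_mul_pi
  have hlt : ∀ {x y : ℝ}, x ∈ Ioi (0 : ℝ) → y ∈ Ioi (0 : ℝ) → (F x < F y ↔ x < y) :=
    fun hx hy => hFmono.lt_iff_lt hx hy
  -- Since the phase increases in `λ`, an eigenvalue is negative exactly when its prescribed phase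
  -- lies below the phase at `0`, which is `F a`.
  have hEneg : ∀ (n : ℕ) {a : ℝ} (ha : 0 < a), n * Real.pi < F a → lamEven n a < 0 := by
    intro n a ha h
    rwa [← (hmono ha).lt_iff_lt, hlamE n a ha, ← hF ha]
  have hOneg : ∀ (n : ℕ) {a : ℝ} (ha : 0 < a), n * Real.pi + Real.pi / 2 < F a →
      lamOdd n a < 0 := by
    intro n a ha h
    rwa [← (hmono ha).lt_iff_lt, hlamO n a ha, ← hF ha]
  refine ⟨lamEven, lamOdd, aEven, aOdd, fun a ha => ⟨?_, ?_⟩, ?_, ?_, fun a ha n => ⟨?_, ?_⟩,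
    fun n => ⟨aOdd n, haO n, fun a ha => ⟨?_, ?_⟩⟩, fun a ha => ?_,
    fun n hn => ⟨fun a ha han => ?_, ?_, fun a han => ?_⟩,
    fun n => ⟨fun a ha han => ?_, ?_, fun a han => ?_⟩, ?_, fun n => ⟨?_, ?_⟩⟩
  · refine EllipsoidSL.enumerates_of_strictMonoOn isUpperSet_univ ((hmono ha).strictMonoOn univ)
      EllipsoidSL.strictMono_mul_pi EllipsoidSL.tendsto_mul_pi
      (fun n _ => ⟨mem_univ _, hlamE n a ha⟩) fun x => ?_
    rw [EllipsoidSL.mem_specEven_iff ha hb hd,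
      EllipsoidSL.sin_eq_zero_iff_exists_nat (hlow ha x)]
    simp
  · refine EllipsoidSL.enumerates_of_strictMonoOn isUpperSet_univ ((hmono ha).strictMonoOn univ)
      htO htO' (fun n _ => ⟨mem_univ _, hlamO n a ha⟩) fun x => ?_
    rw [EllipsoidSL.mem_specOdd_iff ha hb hd,
      EllipsoidSL.cos_eq_zero_iff_exists_nat (hlow ha x)]
    simp
  · refine EllipsoidSL.enumerates_of_strictMonoOn (isUpperSet_Ioi 0) hFmono
      EllipsoidSL.strictMono_mul_pi EllipsoidSL.tendsto_mul_pi hFE fun x => ?_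
    change 0 < x ∧ _ ↔ 0 < x ∧ _
    refine and_congr_right fun hx => ?_
    rw [EllipsoidSL.mem_specEven_iff hx hb hd,
      EllipsoidSL.sin_eq_zero_iff_exists_nat (hlow hx 0), hF hx]
    refine exists_congr fun n => ⟨fun h => ⟨?_, h⟩, fun h => h.2⟩
    -- The value `n = 0` would make the positive phase at `λ = 0` vanish.
    rcases Nat.eq_zero_or_pos n with rfl | hn
    · have := hpos hx
      rw [h] at this
      simp at this
    · exact hn
  · refine EllipsoidSL.enumerates_of_strictMonoOn (isUpperSet_Ioi 0) hFmono htO htO'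
      (fun n _ => hFO n) fun x => ?_
    change 0 < x ∧ _ ↔ 0 < x ∧ _
    refine and_congr_right fun hx => ?_
    rw [EllipsoidSL.mem_specOdd_iff hx hb hd,
      EllipsoidSL.cos_eq_zero_iff_exists_nat (hlow hx 0), hF hx]
    simp
  · rw [← (hmono ha).lt_iff_lt, hlamE n a ha, hlamO n a ha]
    linarith
  · rw [← (hmono ha).lt_iff_lt, hlamO n a ha, hlamE (n + 1) a ha]
    push_cast
    linarith
  -- The threshold `aOdd n` serves both families, since `nπ < nπ + π/2 < F a` beyond it.
  · have ha0 : 0 < a := (haO n).trans ha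
    have h1 := (hlt (hFO n).1 ha0).2 ha
    rw [(hFO n).2] at h1
    exact hEneg n ha0 (by linarith)
  · have ha0 : 0 < a := (haO n).trans ha
    have h1 := (hlt (hFO n).1 ha0).2 ha
    rw [(hFO n).2] at h1
    exact hOneg n ha0 h1
  · exact hEneg 0 ha (by rw [hF ha]; simpa using hpos ha)
  · have h1 := (hlt ha (hFE n hn).1).2 han
    rw [(hFE n hn).2, hF ha] at h1
    rwa [← (hmono ha).lt_iff_lt, hlamE n a ha]
  · obtain ⟨h1, h2⟩ := haE n hn
    exact (hmono h1).injective ((hlamE n _ h1).trans h2.symm)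
  · have ha0 : 0 < a := lt_trans (hFE n hn).1 han
    have h1 := (hlt (hFE n hn).1 ha0).2 han
    rw [(hFE n hn).2] at h1
    exact hEneg n ha0 h1
  · have h1 := (hlt ha (hFO n).1).2 han
    rw [(hFO n).2, hF ha] at h1
    rwa [← (hmono ha).lt_iff_lt, hlamO n a ha]
  · exact (hmono (haO n)).injective ((hlamO n _ (haO n)).trans (hphO n).symm)
  · have ha0 : 0 < a := (haO n).trans han
    have h1 := (hlt (hFO n).1 ha0).2 han
    rw [(hFO n).2] at h1
    exact hOneg n ha0 h1
  -- Both `aOdd 0` and `d` have phase `π/2` at `λ = 0`.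
  · refine hFmono.injOn (hFO 0).1 hd ?_
    rw [(hFO 0).2, hF hd, EllipsoidSL.phase_self hb hd]
    simp
  · have hE1 := hFE (n + 1) (by omega)
    rw [← hlt (hFO n).1 hE1.1, (hFO n).2, hE1.2]
    push_cast
    linarith
  · have hE1 := hFE (n + 1) (by omega)
    rw [← hlt hE1.1 (hFO (n + 1)).1, (hFO (n + 1)).2, hE1.2]
    linarith
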